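/- **Theorem 4.1.** Let $n,k\ge 1$ be integers. Let $J^k(\mathbb R^n)$ be the space of $k$-jets of functions $\mathbb R^n\to\mathbb R$, with its global coordinates $(x,(u_I)_{|I|\le k})$, where $I$ runs over the multi-indices $I\in\mathbb N^n$ with $|I|\le k$ and the jet $j^k_{x_0}(f)$ has coordinates $x=x_0$, $u_I=\partial_I f(x_0)$. Put $$X_i=\partial_{x_i}+\sum_{|I|<k}u_{I+e_i}\,\partial_{u_I}\qquad(i=1,\dots,n),$$ let $\mathcal H_0$ be the subbundle of the tangent bundle spanned by $X_1,\dots,X_n$ and the $\partial_{u_I}$ with $|I|=k$, and let $g_0$ be the Riemannian metric for which $(X_1,\dots,X_n,\partial_{u_I})_{|I|\le k}$ is an orthonormal frame. Let $d_c(p,q)$ be the infimum of the $g_0$-lengths of the $C^1$ curves from $p$ to $q$ whose velocity lies in $\mathcal H_0$ at every point. For all real $\alpha,\beta>0$ and all integers $n,k\ge1$ there is a constant $C=C(\alpha,\beta,n,k)$, depending on nothing else, such that the following holds. Let $X$ be a metric space, $Z\subset X$ a nonempty closed set, and $(B_i)_{i\in I}$ a covering of $X\setminus Z$ by subsets of $X\setminus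 Z$ such that 1. $\operatorname{diam}B_i\le\alpha\, d(B_i,Z)$ for every $i\in I$; 2. every set $D\subset X\setminus Z$ with $\operatorname{diam}D\le\beta\, d(D,Z)$ meets at most $n+1$ members of the family $(B_i)_{i\in I}$. Then, for every $\lambda\ge0$, every $\lambda$-Lipschitz map $f:Z\to(J^k(\mathbb R^n),d_c)$ has a $C\lambda$-Lipschitz extension $\bar f:X\to(J^k(\mathbb R^n),d_c)$. Here $d(A,Z)=\inf\{d(a,z): a\in A,\ z\in Z\}$, and diameters and distances take values in $[0,\infty]$ (so an unbounded set has diameter $\infty$). -/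

import Mathlib

open scoped NNReal ENNReal

noncomputable section

/-- The multi-indices `I = (i_1, …, i_n)` of total degree `|I| ≤ k`. -/
abbrev MultiIdx (n k : ℕ) : Type :=
  {I : Fin n → ℕ // I ∈ (Finset.range (k + 1)).biUnion (Finset.piAntidiag Finset.univ)}

namespace MultiIdx

variable {n k : ℕ}

/-- The degree `|I| = i_1 + ⋯ + i_n`. -/
def deg (I : MultiIdx n k) : ℕ := ∑ i, I.1 i

theorem mem_iff (I : Fin n → ℕ) :
    I ∈ (Finset.range (k + 1)).biUnion (Finset.piAntidiag Finset.univ) ↔ ∑ i, I i ≤ k := by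
  simp [Finset.mem_piAntidiag]

/-- The multi-index `I + e_i`, for `|I| < k`. -/
def addSingle (I : MultiIdx n k) (i : Fin n) (h : I.deg < k) : MultiIdx n k :=
  ⟨I.1 + Pi.single i 1, by
    rw [mem_iff]
    simp only [Pi.add_apply, Finset.sum_add_distrib, Finset.sum_pi_single', Finset.mem_univ,
      if_true]
    exact h⟩

end MultiIdx

/-- The jet space `J^k(ℝ^n)` in its global coordinates: a `k`-jet `j^k_{x₀}(f)` is the pair of its
base point `x = x₀` (first component) and of the family `u_I = ∂_I f(x₀)`, `|I| ≤ k` (second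
component); every such pair is the jet of exactly one Taylor polynomial.  The norm that Lean
finds on this finite-dimensional space is used only for its topology and its differentiable
structure; the metric of interest is `ccDist` below. -/
abbrev JetSpace (n k : ℕ) : Type := (Fin n → ℝ) × (MultiIdx n k → ℝ)

namespace JetSpace

variable {n k : ℕ}

/-- The value at `p` of the vector field
`X_i = ∂_{x_i} + ∑_{|I| < k} u_{I + e_i} ∂_{u_I}`. -/
def fieldX (i : Fin n) (p : JetSpace n k) : JetSpace n k :=
  (Pi.single i 1, fun I => if h : I.deg < k then p.2 (I.addSingle i h) else 0)

/-- The (constant) vector field `∂_{u_I}`. -/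
def fieldU (I : MultiIdx n k) : JetSpace n k := (0, Pi.single I 1)

/-- The horizontal subspace at `p`: the span of the `X_i` and of the `∂_{u_I}` with `|I| = k`. -/
def horizontal (p : JetSpace n k) : Submodule ℝ (JetSpace n k) :=
  Submodule.span ℝ
    (Set.range (fun i => fieldX i p) ∪ fieldU '' {I : MultiIdx n k | I.deg = k})

/-- The `∂_{u_I}`-coefficient of the tangent vector `v` at `p` with respect to the global frame
`(X_1, …, X_n, ∂_{u_I})_{|I| ≤ k}`; the `X_i`-coefficient is `v.1 i`. -/
def coeffU (p v : JetSpace n k) (I : MultiIdx n k) : ℝ :=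
  v.2 I - ∑ i, v.1 i * (fieldX i p).2 I

theorem frame_expansion (p v : JetSpace n k) :
    v = ∑ i, v.1 i • fieldX i p + ∑ I, coeffU p v I • fieldU I := by
  ext j
  · simp [fieldX, fieldU, Prod.fst_sum, Finset.sum_apply, Pi.single_apply]
  · simp [fieldU, coeffU, Prod.snd_sum, Finset.sum_apply, Pi.single_apply]

/-- The left-invariant Riemannian metric `g₀` at `p`: the inner product for which the frame
`(X_1, …, X_n, ∂_{u_I})_{|I| ≤ k}` is orthonormal. -/
def g0 (p v w : JetSpace n k) : ℝ :=
  ∑ i, v.1 i * w.1 i + ∑ I, coeffU p v I * coeffU p w I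

theorem g0_fieldX_fieldX (p : JetSpace n k) (i j : Fin n) :
    g0 p (fieldX i p) (fieldX j p) = if i = j then 1 else 0 := by
  simp [g0, coeffU, fieldX, Pi.single_apply, eq_comm]

theorem g0_fieldX_fieldU (p : JetSpace n k) (i : Fin n) (I : MultiIdx n k) :
    g0 p (fieldX i p) (fieldU I) = 0 := by
  simp [g0, coeffU, fieldX, fieldU, Pi.single_apply]

theorem g0_fieldU_fieldU (p : JetSpace n k) (I J : MultiIdx n k) :
    g0 p (fieldU I) (fieldU J) = if I = J then 1 else 0 := by
  simp [g0, coeffU, fieldU, Pi.single_apply, eq_comm]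

/-- The velocity at time `t` of a curve parametrized by `[0, 1]` (one-sided at the ends). -/
def velocity (γ : ℝ → JetSpace n k) (t : ℝ) : JetSpace n k :=
  derivWithin γ (Set.Icc 0 1) t

/-- `γ`, restricted to `[0, 1]`, is a horizontal `C¹` curve from `p` to `q`. -/
structure IsHorizontalCurve (γ : ℝ → JetSpace n k) (p q : JetSpace n k) : Prop where
  contDiffOn : ContDiffOn ℝ 1 γ (Set.Icc 0 1)
  source : γ 0 = p
  target : γ 1 = q
  velocity_mem : ∀ t ∈ Set.Icc (0 : ℝ) 1, velocity γ t ∈ horizontal (γ t)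

/-- The length of `γ : [0, 1] → J^k(ℝ^n)` for the Riemannian metric `g₀`. -/
def length (γ : ℝ → JetSpace n k) : ℝ :=
  ∫ t in (0 : ℝ)..1, Real.sqrt (g0 (γ t) (velocity γ t) (velocity γ t))

/-- The Carnot–Carathéodory distance `d_c`, as an infimum in `[0, ∞]` of the lengths of the
horizontal `C¹` curves from `p` to `q`. -/
def ccDist (p q : JetSpace n k) : ℝ≥0∞ :=
  ⨅ (γ : ℝ → JetSpace n k) (_ : IsHorizontalCurve γ p q), ENNReal.ofReal (length γ)

end JetSpace

/-- A map from a metric space to `(J^k(ℝ^n), d_c)` is `L`-Lipschitz. -/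
def LipschitzToJet {Y : Type*} [MetricSpace Y] {n k : ℕ} (L : ℝ≥0) (f : Y → JetSpace n k) :
    Prop :=
  ∀ y y' : Y, JetSpace.ccDist (f y) (f y') ≤ L * edist y y'

/-- The distance `d(A, Z) = inf {d(a, z) | a ∈ A, z ∈ Z}` of two sets, in `[0, ∞]`
(so that it is `∞` when `A` or `Z` is empty). -/
def setDist {X : Type*} [MetricSpace X] (A Z : Set X) : ℝ≥0∞ :=
  ⨅ a ∈ A, ⨅ z ∈ Z, edist a z

end

/-!
Lipschitz extension of maps into jet spaces.

A smooth function `G` on `ℝⁿ` lifts a segment of `ℝⁿ` to a horizontal curve, the curve of its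
`k`-jets, and the length of the lift is controlled by the derivatives of `G` of order `k + 1`
(`ccDist_jet_le`).  The extension is therefore sought in the form
`F x = jet of G_x at y(x)`, where `y : X → ℝⁿ` is Lipschitz and, for points `x, x'` whose mutual
distance is small compared to their distance to `Z`, the functions `G_x` and `G_{x'}` can be
replaced by one common function.

Let `d` be the distance to `Z`.  The covering gives a partition of the complement of `Z`, at
scale `d`, modelled on the barycentric subdivision of its nerve
(`exists_coloredBumps`): Lipschitz bumps `b_v` with colours `0, …, n`, where bumps of the same
colour have disjoint supports; the colour is the dimension of the simplex of which `v` is the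
barycentre, so that the multiplicity `n + 1` of the covering is what bounds the number of colours
by that of the vertices of an `n`-simplex.  Each bump `v` has a nearby point `z_v ∈ Z`, hence a
Taylor polynomial `T_v` of the jet `f(z_v)`.  If `x̂` is a Lipschitz extension of the base points
of the jets `f(z)`, and `e_0, …, e_n` are the vertices of a simplex around the origin of `ℝⁿ`, put
`y(x) = x̂(x) + M L ∑ b_v(x) e_{color v}`.

For `M` large, the function `ℓ_v(y - x_v) + const`, where `x_v` is the base point of `f(z_v)` and
`ℓ_v` is a linear form positive at `e_{color v}` and negative at the other vertices, is negative at
`y(x)` whenever `b_v(x)` is zero but `v` is relevant near `x`, and for each `x` it is greater than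
`1` for the bump that is largest at `x` (`weight_eventuallyEq_zero`,
`exists_weight_eventuallyEq_one`).  Cutoffs `Ψ_v` of these functions depend on `v` only, and not on
the point `x` or on a simplex containing it.  So `G_x`, obtained by successively replacing `G` by
`(1 - Ψ_v) G + Ψ_v T_v` over the bumps `v` at `x`, has the same jet at `y(x)` as the function
obtained in this way from the bumps at `x` and those at a near point `x'`
(`exists_common_function`).

The required derivative bounds are scale invariant: jets at distance `≤ ρ` have Taylor polynomials
whose derivatives of order `m` differ by `O(ρ^{k+1-m})` at distances `O(ρ)`
(`IsHorizontalCurve.abs_sub_taylor_le`, `derivBound_taylor_sub`), while those of `Ψ_v` are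
`O(ρ^{-m})` with `ρ = L d`.  The converse comparison `ccDist_le_of_taylor_close` bounds the distance
from `F x` to the nearby given jets, which settles the pairs of points that are far from each other
compared to their distance to `Z`.
-/

noncomputable section

namespace JetSpace

variable {n k : ℕ}

/-! ### Iterated partial derivatives -/

/-- Infinitely differentiable real functions on `ℝⁿ`. -/
abbrev Smooth (G : (Fin n → ℝ) → ℝ) : Prop := ContDiff ℝ ((⊤ : ℕ∞) : WithTop ℕ∞) G

/-- The partial derivative `∂_i G`. -/
def partialDeriv (i : Fin n) (G : (Fin n → ℝ) → ℝ) : (Fin n → ℝ) → ℝ :=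
  fun y => fderiv ℝ G y (Pi.single i 1)

/-- The iterated partial derivative along a list of coordinate directions, the head of the list
being the derivative taken last. -/
def listDeriv : List (Fin n) → ((Fin n → ℝ) → ℝ) → (Fin n → ℝ) → ℝ
  | [], G => G
  | i :: l, G => partialDeriv i (listDeriv l G)

@[simp] theorem listDeriv_nil (G : (Fin n → ℝ) → ℝ) : listDeriv [] G = G := rfl

theorem listDeriv_cons (i : Fin n) (l : List (Fin n)) (G : (Fin n → ℝ) → ℝ) :
    listDeriv (i :: l) G = partialDeriv i (listDeriv l G) := rfl

theorem Smooth.partialDeriv {G : (Fin n → ℝ) → ℝ} (hG : Smooth G) (i : Fin n) :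
    Smooth (partialDeriv i G) :=
  ContDiff.clm_apply (hG.fderiv_right (m := ((⊤ : ℕ∞) : WithTop ℕ∞)) (by simp)) contDiff_const

theorem Smooth.listDeriv {G : (Fin n → ℝ) → ℝ} (hG : Smooth G) (l : List (Fin n)) :
    Smooth (listDeriv l G) := by
  induction l with
  | nil => exact hG
  | cons i l ih => exact ih.partialDeriv i

theorem Smooth.differentiableAt {G : (Fin n → ℝ) → ℝ} (hG : Smooth G) (y : Fin n → ℝ) :
    DifferentiableAt ℝ G y :=
  (ContDiff.differentiable hG (by simp)).differentiableAt

theorem listDeriv_append_singleton (l : List (Fin n)) (i : Fin n) (G : (Fin n → ℝ) → ℝ) :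
    listDeriv (l ++ [i]) G = listDeriv l (partialDeriv i G) := by
  induction l with
  | nil => rfl
  | cons j l ih => simp only [List.cons_append, listDeriv_cons, ih]

theorem partialDeriv_comm {G : (Fin n → ℝ) → ℝ} (hG : Smooth G) (i j : Fin n) :
    partialDeriv i (partialDeriv j G) = partialDeriv j (partialDeriv i G) := by
  have key : ∀ (a b : Fin n) (y : Fin n → ℝ), partialDeriv a (partialDeriv b G) y =
      fderiv ℝ (fderiv ℝ G) y (Pi.single a 1) (Pi.single b 1) := by
    intro a b y
    have hd : DifferentiableAt ℝ (fderiv ℝ G) y :=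
      ((hG.fderiv_right (m := ((⊤ : ℕ∞) : WithTop ℕ∞)) (by simp)).differentiable
        (by simp)).differentiableAt
    have h := (hd.hasFDerivAt.clm_apply (hasFDerivAt_const (Pi.single b (1 : ℝ)) y)).fderiv
    change fderiv ℝ (fun y => fderiv ℝ G y (Pi.single b 1)) y (Pi.single a 1) = _
    rw [h]
    simp
  funext y
  rw [key, key]
  exact (hG.contDiffAt.isSymmSndFDerivAt (by
    simpa using WithTop.coe_le_coe.2 (le_top : (2 : ℕ∞) ≤ ⊤))) _ _

theorem listDeriv_perm {G : (Fin n → ℝ) → ℝ} (hG : Smooth G) {l l' : List (Fin n)}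
    (h : l.Perm l') : listDeriv l G = listDeriv l' G := by
  induction h with
  | nil => rfl
  | cons i _ ih => rw [listDeriv_cons, listDeriv_cons, ih]
  | swap i j l => exact partialDeriv_comm (hG.listDeriv l) _ _
  | trans _ _ ih₁ ih₂ => exact ih₁.trans ih₂

theorem listDeriv_eventuallyEq {G H : (Fin n → ℝ) → ℝ} {y : Fin n → ℝ}
    (h : G =ᶠ[nhds y] H) (l : List (Fin n)) : listDeriv l G =ᶠ[nhds y] listDeriv l H := by
  induction l with
  | nil => exact h
  | cons i l ih => exact ih.fderiv.fun_comp fun A : (Fin n → ℝ) →L[ℝ] ℝ => A (Pi.single i 1)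

theorem partialDeriv_add {G H : (Fin n → ℝ) → ℝ} (hG : Smooth G) (hH : Smooth H) (i : Fin n) :
    partialDeriv i (G + H) = partialDeriv i G + partialDeriv i H := by
  funext y
  simp only [partialDeriv, Pi.add_apply]
  rw [fderiv_add (hG.differentiableAt y) (hH.differentiableAt y)]
  rfl

theorem partialDeriv_sub {G H : (Fin n → ℝ) → ℝ} (hG : Smooth G) (hH : Smooth H) (i : Fin n) :
    partialDeriv i (G - H) = partialDeriv i G - partialDeriv i H := by
  funext y
  simp only [partialDeriv, Pi.sub_apply]
  rw [fderiv_sub (hG.differentiableAt y) (hH.differentiableAt y)]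
  rfl

theorem partialDeriv_mul {G H : (Fin n → ℝ) → ℝ} (hG : Smooth G) (hH : Smooth H) (i : Fin n) :
    partialDeriv i (G * H) = partialDeriv i G * H + G * partialDeriv i H := by
  funext y
  simp only [partialDeriv, Pi.mul_apply, Pi.add_apply]
  rw [fderiv_mul (hG.differentiableAt y) (hH.differentiableAt y)]
  simp [smul_eq_mul]
  ring

theorem listDeriv_add {G H : (Fin n → ℝ) → ℝ} (hG : Smooth G) (hH : Smooth H)
    (l : List (Fin n)) : listDeriv l (G + H) = listDeriv l G + listDeriv l H := by
  induction l with
  | nil => rfl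
  | cons i l ih =>
    rw [listDeriv_cons, ih, partialDeriv_add (hG.listDeriv l) (hH.listDeriv l)]; rfl

theorem listDeriv_sub {G H : (Fin n → ℝ) → ℝ} (hG : Smooth G) (hH : Smooth H)
    (l : List (Fin n)) : listDeriv l (G - H) = listDeriv l G - listDeriv l H := by
  induction l with
  | nil => rfl
  | cons i l ih =>
    rw [listDeriv_cons, ih, partialDeriv_sub (hG.listDeriv l) (hH.listDeriv l)]; rfl

theorem fderiv_apply_eq_sum (G : (Fin n → ℝ) → ℝ) (y v : Fin n → ℝ) :
    fderiv ℝ G y v = ∑ i, v i * partialDeriv i G y := by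
  conv_lhs => rw [pi_eq_sum_univ' v]
  simp only [map_sum, map_smul, smul_eq_mul, partialDeriv]

/-- Chain rule along a curve. -/
theorem Smooth.hasDerivWithinAt_comp {G : (Fin n → ℝ) → ℝ} (hG : Smooth G)
    {c : ℝ → Fin n → ℝ} {v : Fin n → ℝ} {s : Set ℝ} {t : ℝ} (hc : HasDerivWithinAt c v s t) :
    HasDerivWithinAt (fun t => G (c t)) (∑ i, v i * JetSpace.partialDeriv i G (c t)) s t := by
  rw [← fderiv_apply_eq_sum]
  exact (hG.differentiableAt (c t)).hasFDerivAt.comp_hasDerivWithinAt t hc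

/-- Mean value inequality: a bound on the partial derivatives on a convex set bounds the
increments. -/
theorem abs_sub_le_of_partialDeriv_le {G : (Fin n → ℝ) → ℝ} (hG : Smooth G)
    {U : Set (Fin n → ℝ)} (hU : Convex ℝ U) {M : ℝ}
    (hM : ∀ i, ∀ y ∈ U, |partialDeriv i G y| ≤ M) {y y' : Fin n → ℝ} (hy : y ∈ U) (hy' : y' ∈ U) :
    |G y' - G y| ≤ n * M * ‖y' - y‖ := by
  refine hU.norm_image_sub_le_of_norm_fderiv_le (fun x _ => hG.differentiableAt x) ?_ hy hy'
  intro x hx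
  by_cases hn : n = 0
  · subst hn
    have : fderiv ℝ G x = 0 := by
      ext v
      rw [fderiv_apply_eq_sum]; simp
    simp [this]
  have hM0 : 0 ≤ M := (abs_nonneg _).trans (hM ⟨0, Nat.pos_of_ne_zero hn⟩ x hx)
  refine ContinuousLinearMap.opNorm_le_bound _ (by positivity) fun v => ?_
  rw [fderiv_apply_eq_sum]
  refine (Finset.abs_sum_le_sum_abs _ _).trans ?_
  calc ∑ i, |v i * partialDeriv i G x| ≤ ∑ _i : Fin n, ‖v‖ * M := by
        refine Finset.sum_le_sum fun i _ => ?_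
        rw [abs_mul]
        exact mul_le_mul (norm_le_pi_norm v i) (hM i x hx) (abs_nonneg _) (norm_nonneg _)
    _ = n * M * ‖v‖ := by simp; ring

/-! ### Scale-invariant derivative bounds -/

/-- `DerivBound N ρ U C G`: on `U`, the derivatives of `G` of order `m ≤ N` are at most
`C ρ⁻ᵐ`. -/
def DerivBound (N : ℕ) (ρ : ℝ) (U : Set (Fin n → ℝ)) (C : ℝ) (G : (Fin n → ℝ) → ℝ) : Prop :=
  ∀ l : List (Fin n), l.length ≤ N → ∀ y ∈ U, |listDeriv l G y| * ρ ^ l.length ≤ C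

theorem DerivBound.add {N : ℕ} {ρ : ℝ} {U : Set (Fin n → ℝ)} {C D : ℝ} (hρ : 0 ≤ ρ)
    {G H : (Fin n → ℝ) → ℝ}
    (hG : Smooth G) (hH : Smooth H) (bG : DerivBound N ρ U C G) (bH : DerivBound N ρ U D H) :
    DerivBound N ρ U (C + D) (G + H) := by
  intro l hl y hy
  rw [listDeriv_add hG hH, Pi.add_apply]
  have h1 := bG l hl y hy
  have h2 := bH l hl y hy
  have h3 := mul_le_mul_of_nonneg_right (abs_add_le (listDeriv l G y) (listDeriv l H y))
    (pow_nonneg hρ l.length)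
  linarith

theorem DerivBound.sub {N : ℕ} {ρ : ℝ} {U : Set (Fin n → ℝ)} {C D : ℝ} (hρ : 0 ≤ ρ)
    {G H : (Fin n → ℝ) → ℝ}
    (hG : Smooth G) (hH : Smooth H) (bG : DerivBound N ρ U C G) (bH : DerivBound N ρ U D H) :
    DerivBound N ρ U (C + D) (G - H) := by
  intro l hl y hy
  rw [listDeriv_sub hG hH, Pi.sub_apply]
  have h1 := bG l hl y hy
  have h2 := bH l hl y hy
  have h3 := mul_le_mul_of_nonneg_right (abs_sub (listDeriv l G y) (listDeriv l H y))
    (pow_nonneg hρ l.length)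
  linarith

theorem DerivBound.mono {N : ℕ} {ρ : ℝ} {U : Set (Fin n → ℝ)} {C D : ℝ}
    {G : (Fin n → ℝ) → ℝ} (b : DerivBound N ρ U C G) (h : C ≤ D) : DerivBound N ρ U D G :=
  fun l hl y hy => (b l hl y hy).trans h

/-- Leibniz: the two factors may be differentiated up to `2ᴺ` ways. -/
theorem DerivBound.mul {N : ℕ} {ρ : ℝ} {U : Set (Fin n → ℝ)} (hρ : 0 ≤ ρ) {C D : ℝ}
    {G H : (Fin n → ℝ) → ℝ} (hG : Smooth G) (hH : Smooth H)
    (bG : DerivBound N ρ U C G) (bH : DerivBound N ρ U D H) :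
    DerivBound N ρ U (2 ^ N * (C * D)) (G * H) := by
  have key : ∀ (m : ℕ) (a b : ℕ) (A B : ℝ) (G H : (Fin n → ℝ) → ℝ), Smooth G → Smooth H →
      ∀ y : Fin n → ℝ,
      (∀ l : List (Fin n), l.length ≤ m → |listDeriv l G y| * ρ ^ (l.length + a) ≤ A) →
      (∀ l : List (Fin n), l.length ≤ m → |listDeriv l H y| * ρ ^ (l.length + b) ≤ B) →
      ∀ l : List (Fin n), l.length = m →
        |listDeriv l (G * H) y| * ρ ^ (l.length + a + b) ≤ 2 ^ m * (A * B) := by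
    intro m
    induction m with
    | zero =>
      intro a b A B G H _ _ y h1 h2 l hl
      obtain rfl := List.length_eq_zero_iff.1 hl
      have h1 := h1 [] (by simp)
      have h2 := h2 [] (by simp)
      simp only [listDeriv_nil, List.length_nil, zero_add, Pi.mul_apply, pow_zero, one_mul] at *
      rw [abs_mul, pow_add]
      calc |G y| * |H y| * (ρ ^ a * ρ ^ b) = (|G y| * ρ ^ a) * (|H y| * ρ ^ b) := by ring
        _ ≤ A * B := mul_le_mul h1 h2 (by positivity) (le_trans (by positivity) h1)
    | succ m ih =>
      intro a b A B G H hG hH y h1 h2 l hl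
      obtain ⟨l', i, rfl⟩ : ∃ l' i, l = l' ++ [i] :=
        ⟨l.dropLast, l.getLast (by rintro rfl; simp at hl),
          (List.dropLast_append_getLast _).symm⟩
      have hl' : l'.length = m := by simpa using hl
      have hGH : Smooth (partialDeriv i G * H) := (hG.partialDeriv i).mul hH
      have hGH' : Smooth (G * partialDeriv i H) := hG.mul (hH.partialDeriv i)
      rw [listDeriv_append_singleton, partialDeriv_mul hG hH,
        listDeriv_add hGH hGH', Pi.add_apply]
      have e1 := ih (a + 1) b A B (partialDeriv i G) H (hG.partialDeriv i) hH y
        (fun l hl => by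
          have := h1 (l ++ [i]) (by simpa using hl)
          rw [listDeriv_append_singleton] at this
          simpa [add_assoc, add_comm, add_left_comm] using this)
        (fun l hl => h2 l (by lia)) l' hl'
      have e2 := ih a (b + 1) A B G (partialDeriv i H) hG (hH.partialDeriv i) y
        (fun l hl => h1 l (by lia))
        (fun l hl => by
          have := h2 (l ++ [i]) (by simpa using hl)
          rw [listDeriv_append_singleton] at this
          simpa [add_assoc, add_comm, add_left_comm] using this) l' hl'
      have e0 : (l' ++ [i]).length + a + b = l'.length + (a + 1) + b := by simp; ring
      have e0' : l'.length + a + (b + 1) = l'.length + (a + 1) + b := by ring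
      rw [e0]
      rw [e0'] at e2
      have := mul_le_mul_of_nonneg_right (abs_add_le (listDeriv l' (partialDeriv i G * H) y)
        (listDeriv l' (G * partialDeriv i H) y)) (pow_nonneg hρ (l'.length + (a + 1) + b))
      rw [pow_succ]
      linarith
  intro l hl y hy
  have hC : 0 ≤ C := le_trans (by positivity) (bG [] (by simp) y hy)
  have hD : 0 ≤ D := le_trans (by positivity) (bH [] (by simp) y hy)
  have := key l.length 0 0 C D G H hG hH y (fun l' hl' => bG l' (hl'.trans hl) y hy)
    (fun l' hl' => bH l' (hl'.trans hl) y hy) l rfl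
  refine this.trans ?_
  gcongr
  norm_num

/-! ### Cutoffs along linear functionals -/

theorem iteratedDeriv_smoothTransition_bounded (N : ℕ) :
    ∃ C : ℝ, 1 ≤ C ∧ ∀ m ≤ N, ∀ t : ℝ, |iteratedDeriv m Real.smoothTransition t| ≤ C := by
  have one : ∀ m : ℕ, ∃ C : ℝ, ∀ t : ℝ, |iteratedDeriv m Real.smoothTransition t| ≤ C := by
    intro m
    have hcont : Continuous (iteratedDeriv m Real.smoothTransition) :=
      (Real.smoothTransition.contDiff (n := ⊤)).continuous_iteratedDeriv m
        (by exact_mod_cast le_top)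
    obtain ⟨C, hC⟩ := isCompact_Icc.exists_bound_of_continuousOn
      (s := Set.Icc (0 : ℝ) 1) hcont.continuousOn
    refine ⟨max C 1, fun t => ?_⟩
    by_cases ht : t ∈ Set.Icc (0 : ℝ) 1
    · exact (hC t ht).trans (le_max_left _ _)
    · obtain ⟨c, hc, hev⟩ : ∃ c : ℝ, |c| ≤ 1 ∧
          Real.smoothTransition =ᶠ[nhds t] fun _ => c := by
        by_cases h0 : t < 0
        · exact ⟨0, by simp, (gt_mem_nhds h0).mono fun s hs =>
            Real.smoothTransition.zero_of_nonpos (le_of_lt hs)⟩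
        · have h1 : 1 < t := by
            by_contra h
            exact ht ⟨not_lt.1 h0, not_lt.1 h⟩
          exact ⟨1, by simp, (lt_mem_nhds h1).mono fun s hs =>
            Real.smoothTransition.one_of_one_le (le_of_lt hs)⟩
      rw [hev.iteratedDeriv_eq m, iteratedDeriv_const]
      refine le_trans ?_ (le_max_right _ _)
      split_ifs
      · exact hc
      · simp
  choose C hC using one
  refine ⟨1 + ∑ m ∈ Finset.range (N + 1), |C m|, ?_, fun m hm t => ?_⟩
  · have := Finset.sum_nonneg fun m (_ : m ∈ Finset.range (N + 1)) => abs_nonneg (C m)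
    linarith
  · have := Finset.single_le_sum (f := fun m => |C m|) (fun m _ => abs_nonneg _)
      (Finset.mem_range.2 (Nat.lt_succ_of_le hm))
    have h1 := hC m t
    have h2 := le_abs_self (C m)
    linarith

/-- The cutoff `S(⟨a, y⟩ + b)`, where `S` is the smooth step: it is `0` where the affine function
`⟨a, y⟩ + b` is `≤ 0`, and `1` where it is `≥ 1`. -/
def cutoff (a : Fin n → ℝ) (b : ℝ) (y : Fin n → ℝ) : ℝ :=
  Real.smoothTransition (∑ i, a i * y i + b)

theorem smooth_cutoff (a : Fin n → ℝ) (b : ℝ) : Smooth (cutoff a b) := by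
  unfold cutoff
  exact Real.smoothTransition.contDiff.comp (by fun_prop)

theorem listDeriv_cutoff (a : Fin n → ℝ) (b : ℝ) (l : List (Fin n)) :
    listDeriv l (cutoff a b) = fun y => (l.map a).prod *
      iteratedDeriv l.length Real.smoothTransition (∑ i, a i * y i + b) := by
  induction l with
  | nil => simp; rfl
  | cons j l ih =>
    funext y
    rw [listDeriv_cons, ih, partialDeriv]
    have h1 : HasFDerivAt (fun y : Fin n → ℝ => ∑ i, a i * y i + b)
        (∑ i, a i • ContinuousLinearMap.proj (R := ℝ) (φ := fun _ : Fin n => ℝ) i) y := by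
      refine HasFDerivAt.add_const _ (HasFDerivAt.fun_sum fun i _ => ?_)
      exact ((ContinuousLinearMap.proj (R := ℝ) (φ := fun _ : Fin n => ℝ) i).hasFDerivAt).const_mul
        (a i)
    have h2 : HasDerivAt (iteratedDeriv l.length Real.smoothTransition)
        (iteratedDeriv (l.length + 1) Real.smoothTransition (∑ i, a i * y i + b))
        (∑ i, a i * y i + b) := by
      rw [iteratedDeriv_succ]
      refine DifferentiableAt.hasDerivAt ?_
      exact (Real.smoothTransition.contDiff (n := ⊤)).differentiable_iteratedDeriv l.length
        (by exact_mod_cast WithTop.coe_lt_top _) _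
    have h3 := (h2.comp_hasFDerivAt y h1).const_mul (l.map a).prod
    have h4 := h3.fderiv
    simp only [Function.comp_def] at h4
    rw [h4]
    simp [Pi.single_apply]
    ring

/-- The cutoffs obey scale-invariant bounds at the scale of their slope. -/
theorem derivBound_cutoff (N : ℕ) : ∃ C : ℝ, 1 ≤ C ∧ ∀ (a : Fin n → ℝ) (b ρ D : ℝ), 0 ≤ ρ →
    1 ≤ D → (∀ i, |a i| * ρ ≤ D) → DerivBound N ρ Set.univ (D ^ N * C) (cutoff a b) := by
  obtain ⟨C, hC1, hC⟩ := iteratedDeriv_smoothTransition_bounded N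
  refine ⟨C, hC1, fun a b ρ D hρ hD h l hl y _ => ?_⟩
  rw [listDeriv_cutoff, abs_mul]
  have hp : ∀ l : List (Fin n), |(l.map a).prod| * ρ ^ l.length ≤ D ^ l.length := by
    intro l
    induction l with
    | nil => simp
    | cons i l ih =>
      simp only [List.map_cons, List.prod_cons, List.length_cons, abs_mul]
      calc |a i| * |(l.map a).prod| * ρ ^ (l.length + 1)
          = (|a i| * ρ) * (|(l.map a).prod| * ρ ^ l.length) := by ring
        _ ≤ D * D ^ l.length := mul_le_mul (h i) ih (by positivity) (by linarith)
        _ = D ^ (l.length + 1) := by ring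
  calc |(l.map a).prod| * |iteratedDeriv l.length Real.smoothTransition (∑ i, a i * y i + b)| *
        ρ ^ l.length
      = (|(l.map a).prod| * ρ ^ l.length) *
        |iteratedDeriv l.length Real.smoothTransition (∑ i, a i * y i + b)| := by ring
    _ ≤ D ^ l.length * C := mul_le_mul (hp l) (hC _ hl _) (abs_nonneg _) (by positivity)
    _ ≤ D ^ N * C := by gcongr

theorem cutoff_eventuallyEq_zero {a : Fin n → ℝ} {b : ℝ} {y : Fin n → ℝ}
    (h : ∑ i, a i * y i + b < 0) : cutoff a b =ᶠ[nhds y] 0 := by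
  have hc : Continuous fun y : Fin n → ℝ => ∑ i, a i * y i + b := by fun_prop
  exact (hc.continuousAt.eventually_lt_const h).mono fun z hz =>
    Real.smoothTransition.zero_of_nonpos (le_of_lt hz)

theorem cutoff_eventuallyEq_one {a : Fin n → ℝ} {b : ℝ} {y : Fin n → ℝ}
    (h : 1 < ∑ i, a i * y i + b) : cutoff a b =ᶠ[nhds y] 1 := by
  have hc : Continuous fun y : Fin n → ℝ => ∑ i, a i * y i + b := by fun_prop
  exact (hc.continuousAt.eventually_const_lt h).mono fun z hz =>
    Real.smoothTransition.one_of_one_le (le_of_lt hz)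

/-! ### Multi-indices, Taylor polynomials and holonomic jets -/

/-- A list of coordinate directions in which every `i` occurs `I i` times. -/
def dirList (I : Fin n → ℕ) : List (Fin n) :=
  (∑ i, Multiset.replicate (I i) i : Multiset (Fin n)).toList

theorem count_dirList (I : Fin n → ℕ) (i : Fin n) : (dirList I).count i = I i := by
  rw [dirList, ← Multiset.coe_count, Multiset.coe_toList, Multiset.count_sum']
  simp [Multiset.count_replicate]

theorem length_dirList (I : Fin n → ℕ) : (dirList I).length = ∑ i, I i := by
  rw [dirList, Multiset.length_toList]
  simp

/-- The iterated partial derivative `∂_I G`. -/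
def multiDeriv (I : Fin n → ℕ) (G : (Fin n → ℝ) → ℝ) : (Fin n → ℝ) → ℝ :=
  listDeriv (dirList I) G

theorem listDeriv_eq_multiDeriv {G : (Fin n → ℝ) → ℝ} (hG : Smooth G) (l : List (Fin n)) :
    listDeriv l G = multiDeriv (fun i => l.count i) G :=
  listDeriv_perm hG (List.perm_iff_count.2 fun i =>
    (count_dirList (fun i => l.count i) i).symm)

theorem partialDeriv_multiDeriv {G : (Fin n → ℝ) → ℝ} (hG : Smooth G) (i : Fin n)
    (I : Fin n → ℕ) : partialDeriv i (multiDeriv I G) = multiDeriv (I + Pi.single i 1) G := by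
  rw [multiDeriv, ← listDeriv_cons, multiDeriv]
  refine listDeriv_perm hG (List.perm_iff_count.2 fun j => ?_)
  rw [count_dirList, List.count_cons, count_dirList]
  by_cases h : i = j
  · subst h; simp
  · simp [h, Ne.symm h]

/-- The `k`-jet of `G` at `y`. -/
def jet (k : ℕ) (G : (Fin n → ℝ) → ℝ) (y : Fin n → ℝ) : JetSpace n k :=
  (y, fun I => multiDeriv I.1 G y)

theorem jet_congr {G H : (Fin n → ℝ) → ℝ} {y : Fin n → ℝ} (h : G =ᶠ[nhds y] H) :
    jet k G y = jet k H y := by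
  refine Prod.ext rfl (funext fun I => ?_)
  exact (listDeriv_eventuallyEq h _).eq_of_nhds

/-- The normalized monomial `y^I / I!`. -/
def monomial (I : Fin n → ℕ) (y : Fin n → ℝ) : ℝ := ∏ i, y i ^ I i / (I i).factorial

theorem smooth_monomial (I : Fin n → ℕ) : Smooth (monomial I) := by
  unfold monomial
  refine contDiff_prod fun i _ => ?_
  exact ((contDiff_apply ℝ ℝ i).pow _).div_const _

theorem partialDeriv_monomial (I : Fin n → ℕ) (j : Fin n) :
    partialDeriv j (monomial I) =
      if I j = 0 then 0 else monomial (fun i => I i - if i = j then 1 else 0) := by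
  funext y
  have h0 := ((smooth_monomial I).differentiableAt y).lineDeriv_eq_fderiv
    (v := Pi.single j (1 : ℝ))
  rw [partialDeriv, ← h0]
  have h1 : (fun t : ℝ => monomial I (y + t • Pi.single j (1 : ℝ))) = fun t =>
      (∏ i ∈ Finset.univ.erase j, y i ^ I i / (I i).factorial) *
        ((y j + t) ^ I j / (I j).factorial) := by
    funext t
    rw [monomial, ← Finset.prod_erase_mul _ _ (Finset.mem_univ j)]
    congr 1
    · refine Finset.prod_congr rfl fun i hi => ?_
      simp [Finset.ne_of_mem_erase hi]
    · simp
  have h2 : HasDerivAt (fun t : ℝ => (∏ i ∈ Finset.univ.erase j, y i ^ I i / (I i).factorial) *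
        ((y j + t) ^ I j / (I j).factorial))
      ((∏ i ∈ Finset.univ.erase j, y i ^ I i / (I i).factorial) *
        ((I j * (y j + 0) ^ (I j - 1) * 1) / (I j).factorial)) 0 :=
    ((((hasDerivAt_id (0 : ℝ)).const_add (y j)).pow (I j)).div_const _).const_mul _
  rw [lineDeriv, h1, h2.deriv]
  split_ifs with hj
  · simp [hj]
  · rw [monomial, ← Finset.prod_erase_mul _ _ (Finset.mem_univ j)]
    congr 1
    · refine Finset.prod_congr rfl fun i hi => ?_
      simp [Finset.ne_of_mem_erase hi]
    · obtain ⟨m, hm⟩ := Nat.exists_eq_succ_of_ne_zero hj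
      rw [hm]
      simp only [if_true, Nat.succ_eq_add_one, Nat.add_sub_cancel, Nat.factorial_succ]
      push_cast
      field_simp
      ring

theorem listDeriv_monomial (I : Fin n → ℕ) (l : List (Fin n)) :
    listDeriv l (monomial I) =
      if ∀ i, l.count i ≤ I i then monomial (fun i => I i - l.count i) else 0 := by
  induction l with
  | nil => simp
  | cons j l ih =>
    rw [listDeriv_cons, ih]
    by_cases h : ∀ i, l.count i ≤ I i
    · rw [if_pos h, partialDeriv_monomial]
      by_cases hj : I j - l.count j = 0
      · rw [if_pos hj, if_neg]
        intro h'
        have := h' j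
        simp at this
        omega
      · rw [if_neg hj, if_pos]
        · congr 1
          funext i
          by_cases hi : i = j
          · subst hi; simp; omega
          · simp [hi, Ne.symm hi]
        · intro i
          by_cases hi : i = j
          · subst hi; simp; omega
          · simpa [hi, Ne.symm hi] using h i
    · rw [if_neg h, if_neg]
      · funext y
        simp [partialDeriv]
      · intro h'
        refine h fun i => ?_
        have := h' i
        rw [List.count_cons] at this
        omega

theorem monomial_zero (I : Fin n → ℕ) : monomial I 0 = if I = 0 then 1 else 0 := by
  split_ifs with h
  · subst h; simp [monomial]
  · obtain ⟨i, hi⟩ := Function.ne_iff.1 h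
    exact Finset.prod_eq_zero (Finset.mem_univ i) (by simp at hi; simp [hi])

/-- The Taylor polynomial with `k`-jet `p`. -/
def taylor (p : JetSpace n k) (y : Fin n → ℝ) : ℝ :=
  ∑ I : MultiIdx n k, p.2 I * monomial I.1 (y - p.1)

theorem smooth_taylor (p : JetSpace n k) : Smooth (taylor p) := by
  unfold taylor
  refine ContDiff.sum fun I _ => contDiff_const.mul ?_
  exact (smooth_monomial I.1).comp (contDiff_id.sub contDiff_const)

theorem listDeriv_taylor (p : JetSpace n k) (l : List (Fin n)) :
    listDeriv l (taylor p) =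
      fun y => ∑ I : MultiIdx n k, p.2 I * listDeriv l (monomial I.1) (y - p.1) := by
  induction l with
  | nil => rfl
  | cons j l ih =>
    funext y
    rw [listDeriv_cons, ih, partialDeriv]
    have h : HasFDerivAt
        (fun y => ∑ I : MultiIdx n k, p.2 I * listDeriv l (monomial I.1) (y - p.1))
        (∑ I : MultiIdx n k, p.2 I • fderiv ℝ (listDeriv l (monomial I.1)) (y - p.1)) y := by
      refine HasFDerivAt.fun_sum fun I _ => HasFDerivAt.const_mul ?_ _
      exact (hasFDerivAt_comp_sub p.1).2 (((smooth_monomial I.1).listDeriv l).differentiableAt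
        (y - p.1)).hasFDerivAt
    rw [h.fderiv]
    simp [listDeriv_cons, partialDeriv]

theorem multiDeriv_taylor_self (p : JetSpace n k) (J : MultiIdx n k) :
    multiDeriv J.1 (taylor p) p.1 = p.2 J := by
  rw [multiDeriv, listDeriv_taylor]
  simp only [sub_self, listDeriv_monomial, count_dirList]
  rw [Finset.sum_eq_single J]
  · have : (fun i => J.1 i - J.1 i) = 0 := by funext i; simp
    rw [if_pos fun i => le_rfl, this, monomial_zero, if_pos rfl, mul_one]
  · intro I _ hI
    split_ifs with h
    · rw [monomial_zero, if_neg, mul_zero]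
      intro h0
      refine hI (Subtype.ext (funext fun i => ?_))
      have h1 := congrFun h0 i
      have h2 := h i
      simp at h1
      omega
    · simp
  · simp

theorem jet_taylor (p : JetSpace n k) : jet k (taylor p) p.1 = p :=
  Prod.ext rfl (funext fun J => multiDeriv_taylor_self p J)

theorem _root_.MultiIdx.sum_le (I : MultiIdx n k) : ∑ i, I.1 i ≤ k := (MultiIdx.mem_iff I.1).1 I.2

theorem listDeriv_taylor_eq_zero (p : JetSpace n k) {l : List (Fin n)} (hl : k < l.length) :
    listDeriv l (taylor p) = 0 := by
  rw [listDeriv_taylor]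
  funext y
  refine Finset.sum_eq_zero fun I _ => ?_
  rw [listDeriv_monomial, if_neg]
  · simp
  · intro h
    have h1 : ∑ i, l.count i = l.length := by
      simpa using Multiset.sum_count_eq_card (s := Finset.univ) (m := (l : Multiset (Fin n)))
        (by simp)
    have h2 : ∑ i, l.count i ≤ ∑ i, I.1 i := Finset.sum_le_sum fun i _ => h i
    have := I.sum_le
    omega

/-- A polynomial of degree `≤ k` with controlled jet at `x₀` is controlled on a ball around
`x₀`. -/
theorem derivBound_of_jet_bound {P : (Fin n → ℝ) → ℝ} (hP : Smooth P)
    (hz : ∀ l : List (Fin n), l.length = k + 1 → listDeriv l P = 0) {ρ R E : ℝ} (hρ : 0 < ρ)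
    (hR : 0 ≤ R) (hE : 0 ≤ E) {x₀ : Fin n → ℝ}
    (h : ∀ l : List (Fin n), l.length ≤ k → |listDeriv l P x₀| * ρ ^ l.length ≤ E) :
    DerivBound (k + 1) ρ (Metric.closedBall x₀ (R * ρ)) ((1 + n * R) ^ (k + 1) * E) P := by
  have key : ∀ m : ℕ, ∀ l : List (Fin n), l.length + m = k + 1 →
      ∀ y ∈ Metric.closedBall x₀ (R * ρ), |listDeriv l P y| * ρ ^ l.length ≤
        (1 + n * R) ^ m * E := by
    intro m
    induction m with
    | zero =>
      intro l hl y _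
      rw [hz l (by omega)]
      simpa using hE
    | succ m ih =>
      intro l hl y hy
      have hM : ∀ i, ∀ z ∈ Metric.closedBall x₀ (R * ρ), |partialDeriv i (listDeriv l P) z| ≤
          (1 + n * R) ^ m * E / ρ ^ (l.length + 1) := by
        intro i z hz
        rw [le_div_iff₀ (by positivity)]
        simpa [listDeriv_cons] using ih (i :: l) (by simp; omega) z hz
      have h1 := abs_sub_le_of_partialDeriv_le (hP.listDeriv l) (convex_closedBall x₀ (R * ρ)) hM
        (Metric.mem_closedBall_self (by positivity)) hy
      have h2 : ‖y - x₀‖ ≤ R * ρ := by rwa [Metric.mem_closedBall, dist_eq_norm] at hy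
      have h3 : |listDeriv l P y| ≤ |listDeriv l P x₀| +
          n * ((1 + n * R) ^ m * E / ρ ^ (l.length + 1)) * (R * ρ) := by
        have := abs_sub_abs_le_abs_sub (listDeriv l P y) (listDeriv l P x₀)
        have h4 : n * ((1 + n * R) ^ m * E / ρ ^ (l.length + 1)) * ‖y - x₀‖ ≤
          n * ((1 + n * R) ^ m * E / ρ ^ (l.length + 1)) * (R * ρ) := by gcongr
        linarith
      have h5 := h l (by omega)
      calc |listDeriv l P y| * ρ ^ l.length
          ≤ (|listDeriv l P x₀| + n * ((1 + n * R) ^ m * E / ρ ^ (l.length + 1)) * (R * ρ)) *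
            ρ ^ l.length := by gcongr
        _ = |listDeriv l P x₀| * ρ ^ l.length + n * R * ((1 + n * R) ^ m * E) := by
            field_simp
            ring
        _ ≤ E * (1 + n * R) ^ m + n * R * ((1 + n * R) ^ m * E) := by
            have : 1 ≤ (1 + n * R) ^ m := one_le_pow₀ (by
              have : 0 ≤ n * R := by positivity
              linarith)
            have : E * 1 ≤ E * (1 + n * R) ^ m := by gcongr
            linarith
        _ = (1 + n * R) ^ (m + 1) * E := by ring
  intro l hl y hy
  refine (key (k + 1 - l.length) l (by omega) y hy).trans ?_
  gcongr
  · have : 0 ≤ n * R := by positivity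
    linarith
  · omega

/-! ### Horizontal vectors and their length -/

theorem coeffU_add (p v w : JetSpace n k) (I : MultiIdx n k) :
    coeffU p (v + w) I = coeffU p v I + coeffU p w I := by
  simp only [coeffU, Prod.snd_add, Prod.fst_add, Pi.add_apply, add_mul, Finset.sum_add_distrib]
  ring

theorem coeffU_smul (p : JetSpace n k) (c : ℝ) (v : JetSpace n k) (I : MultiIdx n k) :
    coeffU p (c • v) I = c * coeffU p v I := by
  simp only [coeffU, Prod.smul_snd, Prod.smul_fst, Pi.smul_apply, smul_eq_mul, mul_assoc,
    ← Finset.mul_sum, mul_sub]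

theorem mem_horizontal_iff (p v : JetSpace n k) :
    v ∈ horizontal p ↔ ∀ I : MultiIdx n k, I.deg < k → coeffU p v I = 0 := by
  constructor
  · intro hv I hI
    refine Submodule.span_induction (p := fun v _ => coeffU p v I = 0) ?_ ?_ ?_ ?_ hv
    · rintro _ (⟨i, rfl⟩ | ⟨J, hJ, rfl⟩)
      · simp [coeffU, fieldX, Pi.single_apply]
      · have : I ≠ J := by
          rintro rfl
          exact absurd hJ hI.ne
        simp [coeffU, fieldU, this]
    · simp [coeffU]
    · intro v w _ _ h1 h2
      rw [coeffU_add, h1, h2, add_zero]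
    · intro c v _ h
      rw [coeffU_smul, h, mul_zero]
  · intro h
    rw [frame_expansion p v]
    refine add_mem (sum_mem fun i _ => Submodule.smul_mem _ _ ?_) (sum_mem fun I _ => ?_)
    · exact Submodule.subset_span (Or.inl ⟨i, rfl⟩)
    · by_cases hI : I.deg < k
      · rw [h I hI, zero_smul]
        exact zero_mem _
      · refine Submodule.smul_mem _ _ (Submodule.subset_span (Or.inr ⟨I, ?_, rfl⟩))
        have : I.deg ≤ k := I.sum_le
        exact le_antisymm this (not_lt.1 hI)

/-- The `g₀`-norm of the tangent vector `v` at `p`. -/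
def speed (p v : JetSpace n k) : ℝ := Real.sqrt (g0 p v v)

theorem g0_self_eq (p v : JetSpace n k) :
    g0 p v v = ∑ i, v.1 i ^ 2 + ∑ I, coeffU p v I ^ 2 := by
  simp [g0, sq]

theorem speed_nonneg (p v : JetSpace n k) : 0 ≤ speed p v := Real.sqrt_nonneg _

theorem abs_fst_le_speed (p v : JetSpace n k) (i : Fin n) : |v.1 i| ≤ speed p v := by
  refine Real.abs_le_sqrt ?_
  rw [g0_self_eq]
  have h1 := Finset.single_le_sum (f := fun i => v.1 i ^ 2) (fun i _ => sq_nonneg _)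
    (Finset.mem_univ i)
  have h2 : 0 ≤ ∑ I, coeffU p v I ^ 2 := Finset.sum_nonneg fun I _ => sq_nonneg _
  exact h1.trans (le_add_of_nonneg_right h2)

theorem abs_coeffU_le_speed (p v : JetSpace n k) (I : MultiIdx n k) :
    |coeffU p v I| ≤ speed p v := by
  refine Real.abs_le_sqrt ?_
  rw [g0_self_eq]
  have h1 := Finset.single_le_sum (f := fun I => coeffU p v I ^ 2) (fun i _ => sq_nonneg _)
    (Finset.mem_univ I)
  have h2 : 0 ≤ ∑ i, v.1 i ^ 2 := Finset.sum_nonneg fun I _ => sq_nonneg _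
  exact h1.trans (le_add_of_nonneg_left h2)

theorem speed_le_sum (p v : JetSpace n k) :
    speed p v ≤ ∑ i, |v.1 i| + ∑ I, |coeffU p v I| := by
  have h1 : 0 ≤ ∑ i, |v.1 i| := Finset.sum_nonneg fun _ _ => abs_nonneg _
  have h2 : 0 ≤ ∑ I, |coeffU p v I| := Finset.sum_nonneg fun _ _ => abs_nonneg _
  refine Real.sqrt_le_iff.2 ⟨add_nonneg h1 h2, ?_⟩
  rw [g0_self_eq]
  have h3 := Finset.sum_sq_le_sq_sum_of_nonneg (s := Finset.univ) (f := fun i => |v.1 i|)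
    fun _ _ => abs_nonneg _
  have h4 := Finset.sum_sq_le_sq_sum_of_nonneg (s := Finset.univ) (f := fun I => |coeffU p v I|)
    fun _ _ => abs_nonneg _
  simp only [sq_abs] at h3 h4
  nlinarith [mul_nonneg h1 h2]

theorem speed_smul (p : JetSpace n k) (c : ℝ) (v : JetSpace n k) :
    speed p (c • v) = |c| * speed p v := by
  rw [speed, speed, ← Real.sqrt_sq_eq_abs, ← Real.sqrt_mul (sq_nonneg c), g0_self_eq, g0_self_eq]
  congr 1
  simp only [coeffU_smul, Prod.smul_fst, Pi.smul_apply, smul_eq_mul, mul_pow, ← Finset.mul_sum,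
    mul_add]

theorem continuous_speed : Continuous fun z : JetSpace n k × JetSpace n k => speed z.1 z.2 := by
  have h : ∀ (i : Fin n) (I : MultiIdx n k),
      Continuous fun z : JetSpace n k × JetSpace n k => (fieldX i z.1).2 I := by
    intro i I
    unfold fieldX
    by_cases hI : I.deg < k
    · simp only [hI, dif_pos]; fun_prop
    · simp only [hI]; exact continuous_const
  have h' : ∀ I : MultiIdx n k,
      Continuous fun z : JetSpace n k × JetSpace n k => coeffU z.1 z.2 I := by
    intro I
    unfold coeffU
    refine Continuous.sub (by fun_prop) (continuous_finsetSum _ fun i _ => ?_)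
    exact Continuous.mul (by fun_prop) (h i I)
  simp only [speed, g0_self_eq]
  refine Real.continuous_sqrt.comp (Continuous.add (by fun_prop) ?_)
  exact continuous_finsetSum _ fun I _ => (h' I).pow 2

theorem continuousOn_speed {a b : ℝ → JetSpace n k} {s : Set ℝ} (ha : ContinuousOn a s)
    (hb : ContinuousOn b s) : ContinuousOn (fun t => speed (a t) (b t)) s :=
  continuous_speed.comp_continuousOn (ha.prodMk hb)

/-! ### Basic properties of the distance `ccDist` -/

/-- A curve with an explicit continuous horizontal derivative is a horizontal curve. -/
theorem isHorizontalCurve_of_hasDerivWithinAt {γ v : ℝ → JetSpace n k}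
    (hd : ∀ t ∈ Set.Icc (0 : ℝ) 1, HasDerivWithinAt γ (v t) (Set.Icc 0 1) t)
    (hc : ContinuousOn v (Set.Icc 0 1))
    (hh : ∀ t ∈ Set.Icc (0 : ℝ) 1, v t ∈ horizontal (γ t)) :
    IsHorizontalCurve γ (γ 0) (γ 1) ∧ ∀ t ∈ Set.Icc (0 : ℝ) 1, velocity γ t = v t := by
  have hv : ∀ t ∈ Set.Icc (0 : ℝ) 1, velocity γ t = v t := fun t ht =>
    (hd t ht).derivWithin (uniqueDiffOn_Icc zero_lt_one t ht)
  refine ⟨⟨?_, rfl, rfl, fun t ht => by rw [hv t ht]; exact hh t ht⟩, hv⟩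
  rw [contDiffOn_one_iff_derivWithin (uniqueDiffOn_Icc zero_lt_one)]
  exact ⟨fun t ht => (hd t ht).differentiableWithinAt, hc.congr hv⟩

theorem ccDist_le_ofReal_length {γ v : ℝ → JetSpace n k}
    (hd : ∀ t ∈ Set.Icc (0 : ℝ) 1, HasDerivWithinAt γ (v t) (Set.Icc 0 1) t)
    (hc : ContinuousOn v (Set.Icc 0 1))
    (hh : ∀ t ∈ Set.Icc (0 : ℝ) 1, v t ∈ horizontal (γ t)) :
    ccDist (γ 0) (γ 1) ≤ ENNReal.ofReal (∫ t in (0 : ℝ)..1, speed (γ t) (v t)) := by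
  obtain ⟨h1, h2⟩ := isHorizontalCurve_of_hasDerivWithinAt hd hc hh
  refine (iInf₂_le γ h1).trans (ENNReal.ofReal_le_ofReal (le_of_eq ?_))
  refine intervalIntegral.integral_congr fun t ht => ?_
  rw [Set.uIcc_of_le zero_le_one] at ht
  simp only [speed, h2 t ht]

theorem IsHorizontalCurve.hasDerivWithinAt {γ : ℝ → JetSpace n k} {p q : JetSpace n k}
    (h : IsHorizontalCurve γ p q) {t : ℝ} (ht : t ∈ Set.Icc (0 : ℝ) 1) :
    HasDerivWithinAt γ (velocity γ t) (Set.Icc 0 1) t :=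
  ((h.contDiffOn.differentiableOn one_ne_zero) t ht).hasDerivWithinAt

theorem IsHorizontalCurve.continuousOn_velocity {γ : ℝ → JetSpace n k} {p q : JetSpace n k}
    (h : IsHorizontalCurve γ p q) : ContinuousOn (velocity γ) (Set.Icc 0 1) :=
  ((contDiffOn_one_iff_derivWithin (uniqueDiffOn_Icc zero_lt_one)).1 h.contDiffOn).2

theorem IsHorizontalCurve.continuousOn_speed {γ : ℝ → JetSpace n k} {p q : JetSpace n k}
    (h : IsHorizontalCurve γ p q) :
    ContinuousOn (fun t => speed (γ t) (velocity γ t)) (Set.Icc 0 1) := by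
  have h1 : ContinuousOn γ (Set.Icc 0 1) := h.contDiffOn.continuousOn
  have h2 := h.continuousOn_velocity
  exact JetSpace.continuousOn_speed h1 h2

theorem length_eq (γ : ℝ → JetSpace n k) :
    length γ = ∫ t in (0 : ℝ)..1, speed (γ t) (velocity γ t) := by
  simp only [length, speed]

theorem ccDist_symm_le (p q : JetSpace n k) : ccDist q p ≤ ccDist p q := by
  refine le_iInf₂ fun γ hγ => ?_
  have hmem : ∀ t ∈ Set.Icc (0 : ℝ) 1, 1 - t ∈ Set.Icc (0 : ℝ) 1 := fun t ht =>
    ⟨by linarith [ht.2], by linarith [ht.1]⟩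
  have hd : ∀ t ∈ Set.Icc (0 : ℝ) 1, HasDerivWithinAt (fun t => γ (1 - t))
      ((-1 : ℝ) • velocity γ (1 - t)) (Set.Icc 0 1) t := fun t ht =>
    (hγ.hasDerivWithinAt (hmem t ht)).scomp t
      (((hasDerivAt_id t).const_sub 1).hasDerivWithinAt) hmem
  have h := ccDist_le_ofReal_length hd
    ((hγ.continuousOn_velocity.comp (by fun_prop) hmem).const_smul (-1 : ℝ))
    (fun t ht => Submodule.smul_mem _ _ (hγ.velocity_mem _ (hmem t ht)))
  simp only [sub_zero, sub_self, hγ.source, hγ.target] at h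
  refine h.trans (ENNReal.ofReal_le_ofReal (le_of_eq ?_))
  simp only [speed_smul, abs_neg, abs_one, one_mul, length_eq]
  rw [intervalIntegral.integral_comp_sub_left (fun t => speed (γ t) (velocity γ t)) 1]
  simp

theorem ccDist_comm (p q : JetSpace n k) : ccDist p q = ccDist q p :=
  le_antisymm (ccDist_symm_le q p) (ccDist_symm_le p q)

theorem deriv_smoothTransition_eq_zero {t : ℝ} (ht : t ≤ 0 ∨ 1 ≤ t) :
    deriv Real.smoothTransition t = 0 := by
  rcases ht with ht | ht
  · refine IsLocalMin.deriv_eq_zero (Filter.Eventually.of_forall fun s => ?_)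
    rw [Real.smoothTransition.zero_of_nonpos ht]
    exact Real.smoothTransition.nonneg s
  · refine IsLocalMax.deriv_eq_zero (Filter.Eventually.of_forall fun s => ?_)
    rw [Real.smoothTransition.one_of_one_le ht]
    exact Real.smoothTransition.le_one s

theorem hasDerivAt_smoothTransition (t : ℝ) :
    HasDerivAt Real.smoothTransition (deriv Real.smoothTransition t) t :=
  ((Real.smoothTransition.contDiff (n := 1)).differentiable (by simp) t).hasDerivAt

theorem continuous_deriv_smoothTransition : Continuous (deriv Real.smoothTransition) :=
  (Real.smoothTransition.contDiff (n := 1)).continuous_deriv (by simp)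

theorem smoothTransition_mem_Icc (t : ℝ) : Real.smoothTransition t ∈ Set.Icc (0 : ℝ) 1 :=
  ⟨Real.smoothTransition.nonneg t, Real.smoothTransition.le_one t⟩

/-- Change of variables for the smooth step, traversed on `[a / 2, (a + 1) / 2]`. -/
theorem integral_comp_smoothTransition {g : ℝ → ℝ} (hg : ContinuousOn g (Set.Icc 0 1)) (a : ℝ) :
    ∫ t in (a / 2)..((a + 1) / 2), g (Real.smoothTransition (2 * t - a)) *
      (deriv Real.smoothTransition (2 * t - a) * 2) = ∫ t in (0 : ℝ)..1, g t := by
  have hext := (continuousOn_iff_continuous_domRestrict.1 hg).Icc_extend' (h := zero_le_one)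
  have key := intervalIntegral.integral_comp_mul_deriv (a := a / 2) (b := (a + 1) / 2)
    (f := fun t => Real.smoothTransition (2 * t - a))
    (f' := fun t => deriv Real.smoothTransition (2 * t - a) * 2)
    (g := Set.IccExtend (zero_le_one' ℝ) ((Set.Icc 0 1).domRestrict g))
    (fun t _ => by
      have h1 : HasDerivAt (fun t : ℝ => 2 * t - a) 2 t := by
        simpa using ((hasDerivAt_id t).const_mul 2).sub_const a
      exact (hasDerivAt_smoothTransition (2 * t - a)).comp t h1)
    ((continuous_deriv_smoothTransition.comp (by fun_prop)).mul continuous_const).continuousOn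
    hext
  have e1 : 2 * (a / 2) - a = 0 := by ring
  have e2 : 2 * ((a + 1) / 2) - a = 1 := by ring
  simp only [e1, e2, Real.smoothTransition.zero, Real.smoothTransition.one] at key
  have hr : ∀ t ∈ Set.Icc (0 : ℝ) 1,
      Set.IccExtend (zero_le_one' ℝ) ((Set.Icc 0 1).domRestrict g) t = g t := fun t ht => by
    rw [Set.IccExtend_of_mem _ _ ht]
    rfl
  rw [← intervalIntegral.integral_congr (μ := MeasureTheory.volume) fun t ht =>
    hr t (by rwa [Set.uIcc_of_le zero_le_one] at ht), ← key]
  refine intervalIntegral.integral_congr fun t _ => ?_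
  simp only [Function.comp]
  rw [hr _ (smoothTransition_mem_Icc _)]

/-- Concatenation: both curves are reparametrized by the smooth step, so that they stop at their
end points, and `t ↦ γ₁(S(2t)) + γ₂(S(2t - 1)) - q` is `C¹` because at every time one of the two
moving terms is equal to `q`. -/
theorem ccDist_triangle (p q r : JetSpace n k) : ccDist p r ≤ ccDist p q + ccDist q r := by
  conv_rhs => rw [ccDist, ccDist]
  simp only [ENNReal.iInf_add, ENNReal.add_iInf]
  refine le_iInf fun γ₂ => le_iInf fun h₂ => le_iInf fun γ₁ => le_iInf fun h₁ => ?_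
  have hl : ∀ γ : ℝ → JetSpace n k, 0 ≤ length γ := fun γ =>
    intervalIntegral.integral_nonneg zero_le_one fun t _ => Real.sqrt_nonneg _
  rw [← ENNReal.ofReal_add (hl γ₁) (hl γ₂)]
  set S := Real.smoothTransition with hS
  have half : ∀ {γ : ℝ → JetSpace n k} {p q : JetSpace n k}, IsHorizontalCurve γ p q → ∀ a t : ℝ,
      HasDerivAt (fun t => γ (S (2 * t - a)))
        ((deriv S (2 * t - a) * 2) • velocity γ (S (2 * t - a))) t := by
    intro γ p q h a t
    have h1 : HasDerivAt (fun t : ℝ => 2 * t - a) 2 t := by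
      simpa using ((hasDerivAt_id t).const_mul 2).sub_const a
    have h2 : HasDerivAt (fun t : ℝ => S (2 * t - a)) (deriv S (2 * t - a) * 2) t :=
      HasDerivAt.comp (h₂ := S) t (hasDerivAt_smoothTransition (2 * t - a)) h1
    exact HasDerivWithinAt.scomp_hasDerivAt t (h := fun t => S (2 * t - a))
      (h.hasDerivWithinAt (smoothTransition_mem_Icc (2 * t - a))) h2
      (fun s => smoothTransition_mem_Icc _)
  have cont : ∀ {γ : ℝ → JetSpace n k} {p q : JetSpace n k}, IsHorizontalCurve γ p q → ∀ a : ℝ,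
      Continuous fun t => (deriv S (2 * t - a) * 2) • velocity γ (S (2 * t - a)) := by
    intro γ p q h a
    refine Continuous.fun_smul ?_ ?_
    · exact (continuous_deriv_smoothTransition.comp (by fun_prop)).mul continuous_const
    · exact h.continuousOn_velocity.comp_continuous
        (Real.smoothTransition.continuous.comp (by fun_prop)) fun t => smoothTransition_mem_Icc _
  set σ : ℝ → JetSpace n k := fun t => γ₁ (S (2 * t - 0)) + γ₂ (S (2 * t - 1)) - q with hσ
  set v : ℝ → JetSpace n k := fun t =>
    (deriv S (2 * t - 0) * 2) • velocity γ₁ (S (2 * t - 0)) +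
      (deriv S (2 * t - 1) * 2) • velocity γ₂ (S (2 * t - 1)) with hv
  have hd : ∀ t, HasDerivAt σ (v t) t := fun t => ((half h₁ 0 t).add (half h₂ 1 t)).sub_const q
  have first : ∀ t ≤ (1 / 2 : ℝ), σ t = γ₁ (S (2 * t - 0)) ∧
      v t = (deriv S (2 * t - 0) * 2) • velocity γ₁ (S (2 * t - 0)) := by
    intro t ht
    have h0 : 2 * t - 1 ≤ 0 := by linarith
    have e1 : S (2 * t - 1) = 0 := Real.smoothTransition.zero_of_nonpos h0
    have e2 : deriv S (2 * t - 1) = 0 := deriv_smoothTransition_eq_zero (Or.inl h0)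
    constructor
    · simp only [hσ, e1, h₂.source]; abel
    · simp only [hv, e2, zero_mul, zero_smul, add_zero]
  have second : ∀ t, (1 / 2 : ℝ) ≤ t → σ t = γ₂ (S (2 * t - 1)) ∧
      v t = (deriv S (2 * t - 1) * 2) • velocity γ₂ (S (2 * t - 1)) := by
    intro t ht
    have h0 : 1 ≤ 2 * t - 0 := by linarith
    have e1 : S (2 * t - 0) = 1 := Real.smoothTransition.one_of_one_le h0
    have e2 : deriv S (2 * t - 0) = 0 := deriv_smoothTransition_eq_zero (Or.inr h0)
    constructor
    · simp only [hσ, e1, h₁.target]; abel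
    · simp only [hv, e2, zero_mul, zero_smul, zero_add]
  have vcont : Continuous v := (cont h₁ 0).add (cont h₂ 1)
  have h := ccDist_le_ofReal_length (γ := σ) (v := v) (fun t _ => (hd t).hasDerivWithinAt)
    vcont.continuousOn (fun t _ => by
      rcases le_total t (1 / 2) with ht | ht
      · rw [(first t ht).1, (first t ht).2]
        exact Submodule.smul_mem _ _ (h₁.velocity_mem _ (smoothTransition_mem_Icc _))
      · rw [(second t ht).1, (second t ht).2]
        exact Submodule.smul_mem _ _ (h₂.velocity_mem _ (smoothTransition_mem_Icc _)))
  have e0 : σ 0 = p := by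
    rw [(first 0 (by norm_num)).1]
    simp [hS, h₁.source]
  have e1 : σ 1 = r := by
    rw [(second 1 (by norm_num)).1]
    have : (2 : ℝ) * 1 - 1 = 1 := by norm_num
    rw [this, hS, Real.smoothTransition.one, h₂.target]
  rw [e0, e1] at h
  refine h.trans (ENNReal.ofReal_le_ofReal (le_of_eq ?_))
  have scont : Continuous fun t => speed (σ t) (v t) :=
    continuous_speed.comp ((continuous_iff_continuousAt.2 fun t => (hd t).continuousAt).prodMk vcont)
  have Sd : ∀ t, 0 ≤ deriv S t * 2 := fun t =>
    mul_nonneg (Real.smoothTransition.monotone.deriv_nonneg) (by norm_num)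
  rw [← intervalIntegral.integral_add_adjacent_intervals (b := 1 / 2)
    (scont.intervalIntegrable _ _) (scont.intervalIntegrable _ _), length_eq, length_eq,
    ← integral_comp_smoothTransition h₁.continuousOn_speed 0,
    ← integral_comp_smoothTransition h₂.continuousOn_speed 1]
  congr 1
  · norm_num only
    refine intervalIntegral.integral_congr fun t ht => ?_
    rw [Set.uIcc_of_le (by norm_num)] at ht
    rw [(first t ht.2).1, (first t ht.2).2, speed_smul, abs_of_nonneg (Sd _), mul_comm]
  · norm_num only
    refine intervalIntegral.integral_congr fun t ht => ?_
    rw [Set.uIcc_of_le (by norm_num)] at ht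
    rw [(second t ht.1).1, (second t ht.1).2, speed_smul, abs_of_nonneg (Sd _), mul_comm]

/-! ### Comparison of `ccDist` with jets of functions -/

theorem fieldX_jet {G : (Fin n → ℝ) → ℝ} (hG : Smooth G) (y : Fin n → ℝ) (i : Fin n)
    {I : MultiIdx n k} (hI : I.deg < k) :
    (fieldX i (jet k G y)).2 I = partialDeriv i (multiDeriv I.1 G) y := by
  rw [partialDeriv_multiDeriv hG]
  simp [fieldX, hI, jet, MultiIdx.addSingle]

theorem fieldX_of_deg_eq (i : Fin n) (p : JetSpace n k) {I : MultiIdx n k} (hI : ¬ I.deg < k) :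
    (fieldX i p).2 I = 0 := by
  simp [fieldX, hI]

/-- The jets of one smooth function along a segment form a horizontal curve, whose length is
controlled by the derivatives of order `k + 1`. -/
theorem ccDist_jet_le {G : (Fin n → ℝ) → ℝ} (hG : Smooth G) {U : Set (Fin n → ℝ)}
    (hU : Convex ℝ U) {M : ℝ}
    (hM : ∀ l : List (Fin n), l.length = k + 1 → ∀ y ∈ U, |listDeriv l G y| ≤ M)
    {y y' : Fin n → ℝ} (hy : y ∈ U) (hy' : y' ∈ U) :
    ccDist (jet k G y) (jet k G y') ≤
      ENNReal.ofReal ((n + Fintype.card (MultiIdx n k) * (n * M)) * ‖y' - y‖) := by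
  set c : ℝ → Fin n → ℝ := fun t => y + t • (y' - y) with hc
  set w : Fin n → ℝ := y' - y with hw
  set v : ℝ → JetSpace n k := fun t =>
    (w, fun I => ∑ i, w i * partialDeriv i (multiDeriv I.1 G) (c t)) with hv
  have hcd : ∀ t, HasDerivAt c w t := fun t => by
    have := ((hasDerivAt_id t).smul_const w).const_add y
    rwa [one_smul] at this
  have hcc : Continuous c := continuous_iff_continuousAt.2 fun t => (hcd t).continuousAt
  have hd : ∀ t, HasDerivWithinAt (fun t => jet k G (c t)) (v t) (Set.Icc 0 1) t := by
    intro t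
    refine HasDerivWithinAt.prodMk (hcd t).hasDerivWithinAt (hasDerivWithinAt_pi.2 fun I => ?_)
    exact (hG.listDeriv (dirList I.1)).hasDerivWithinAt_comp (hcd t).hasDerivWithinAt
  have hvc : Continuous v := by
    refine continuous_const.prodMk (continuous_pi fun I => continuous_finsetSum _ fun i _ => ?_)
    exact continuous_const.mul
      (((hG.listDeriv (dirList I.1)).partialDeriv i).continuous.comp hcc)
  have coeff : ∀ (t : ℝ) (I : MultiIdx n k), I.deg < k →
      coeffU (jet k G (c t)) (v t) I = 0 := by
    intro t I hI
    simp only [coeffU, fieldX_jet hG _ _ hI, hv, sub_self]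
  have cU : ∀ t ∈ Set.Icc (0 : ℝ) 1, c t ∈ U := by
    intro t ht
    have : c t = AffineMap.lineMap y y' t := by
      rw [AffineMap.lineMap_apply]; simp [hc, hw, add_comm]
    rw [this]
    exact hU.lineMap_mem hy hy' ht
  have h := ccDist_le_ofReal_length (fun t _ => hd t) hvc.continuousOn
    (fun t _ => (mem_horizontal_iff _ _).2 (coeff t))
  have e0 : c 0 = y := by simp [hc]
  have e1 : c 1 = y' := by simp [hc, hw]
  simp only [e0, e1] at h
  refine h.trans (ENNReal.ofReal_le_ofReal ?_)
  have hbd : ∀ t ∈ Set.uIoc (0 : ℝ) 1, ‖speed (jet k G (c t)) (v t)‖ ≤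
      (n + Fintype.card (MultiIdx n k) * (n * M)) * ‖w‖ := by
    intro t ht
    rw [Set.uIoc_of_le zero_le_one] at ht
    have htI : t ∈ Set.Icc (0 : ℝ) 1 := ⟨ht.1.le, ht.2⟩
    rw [Real.norm_of_nonneg (speed_nonneg _ _)]
    refine (speed_le_sum _ _).trans ?_
    have a1 : ∑ i, |(v t).1 i| ≤ n * ‖w‖ := by
      refine (Finset.sum_le_card_nsmul _ _ ‖w‖ fun i _ => norm_le_pi_norm w i).trans ?_
      simp
    have a2 : ∀ I : MultiIdx n k, |coeffU (jet k G (c t)) (v t) I| ≤ n * M * ‖w‖ := by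
      intro I
      by_cases hI : I.deg < k
      · rw [coeff t I hI, abs_zero]
        by_cases hn : n = 0
        · subst hn; simp
        have hM0 : 0 ≤ M := (abs_nonneg _).trans
          (hM (List.replicate (k + 1) ⟨0, Nat.pos_of_ne_zero hn⟩) (by simp) y hy)
        positivity
      · have hIk : ∑ i, I.1 i = k := le_antisymm I.sum_le (not_lt.1 hI)
        simp only [coeffU, fieldX_of_deg_eq _ _ hI, mul_zero, Finset.sum_const_zero, sub_zero, hv]
        refine (Finset.abs_sum_le_sum_abs _ _).trans ?_
        calc ∑ i, |w i * partialDeriv i (multiDeriv I.1 G) (c t)|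
            ≤ ∑ _i : Fin n, ‖w‖ * M := by
              refine Finset.sum_le_sum fun i _ => ?_
              rw [abs_mul]
              refine mul_le_mul (norm_le_pi_norm w i) ?_ (abs_nonneg _) (norm_nonneg _)
              exact hM (i :: dirList I.1) (by simp [length_dirList, hIk]) _ (cU t htI)
          _ = n * M * ‖w‖ := by simp; ring
    have a3 : ∑ I, |coeffU (jet k G (c t)) (v t) I| ≤
        Fintype.card (MultiIdx n k) * (n * M * ‖w‖) := by
      refine (Finset.sum_le_card_nsmul _ _ _ fun I _ => a2 I).trans ?_
      simp
    calc _ ≤ n * ‖w‖ + Fintype.card (MultiIdx n k) * (n * M * ‖w‖) := add_le_add a1 a3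
      _ = _ := by ring
  have := intervalIntegral.norm_integral_le_of_norm_le_const hbd
  simp only [sub_zero, abs_one, mul_one] at this
  exact (le_abs_self _).trans this

/-- Along a horizontal curve starting at `p`, the coordinate `u_J` stays close to the derivative
`∂_J` of the Taylor polynomial of `p`: by induction on `k - |J|`, the error `w_J` satisfies
`w_J' = ∑ x_i' w_{J + e_i}`. -/
theorem IsHorizontalCurve.abs_sub_taylor_le {γ : ℝ → JetSpace n k} {p q : JetSpace n k}
    (h : IsHorizontalCurve γ p q) :
    (∀ i, |q.1 i - p.1 i| ≤ length γ) ∧ ∀ J : MultiIdx n k,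
      |q.2 J - multiDeriv J.1 (taylor p) q.1| ≤
        n ^ (k - J.deg) * length γ ^ (k - J.deg + 1) := by
  set g : ℝ → ℝ := Set.IccExtend (zero_le_one' ℝ)
    ((Set.Icc 0 1).domRestrict fun t => speed (γ t) (velocity γ t)) with hg
  have gcont : Continuous g :=
    (continuousOn_iff_continuous_domRestrict.1 h.continuousOn_speed).Icc_extend'
  have geq : ∀ t ∈ Set.Icc (0 : ℝ) 1, g t = speed (γ t) (velocity γ t) := fun t ht => by
    rw [hg, Set.IccExtend_of_mem _ _ ht]; rfl
  have g0 : ∀ t, 0 ≤ g t := fun t => by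
    simp only [hg, Set.IccExtend, Function.comp]
    exact speed_nonneg _ _
  set s : ℝ → ℝ := fun t => ∫ r in (0 : ℝ)..t, g r with hs
  have sd : ∀ t, HasDerivAt s (g t) t := fun t =>
    intervalIntegral.integral_hasDerivAt_right (gcont.intervalIntegrable _ _)
      (gcont.stronglyMeasurableAtFilter _ _) gcont.continuousAt
  have s0 : s 0 = 0 := by simp [hs]
  have s1 : s 1 = length γ := by
    rw [length_eq]
    refine intervalIntegral.integral_congr fun t ht => ?_
    rw [Set.uIcc_of_le zero_le_one] at ht
    exact geq t ht
  have smono : Monotone s := monotone_of_hasDerivAt_nonneg sd g0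
  have sle : ∀ t ∈ Set.Icc (0 : ℝ) 1, s t ≤ length γ := fun t ht => s1 ▸ smono ht.2
  have ℓ0 : 0 ≤ length γ := by rw [← s1, ← s0]; exact smono zero_le_one
  have hd : ∀ t ∈ Set.Icc (0 : ℝ) 1, HasDerivWithinAt γ (velocity γ t) (Set.Icc 0 1) t :=
    fun t ht => h.hasDerivWithinAt ht
  have hd1 : ∀ t ∈ Set.Icc (0 : ℝ) 1,
      HasDerivWithinAt (fun t => (γ t).1) (velocity γ t).1 (Set.Icc 0 1) t :=
    fun t ht => (hd t ht).fst
  have hd2 : ∀ J : MultiIdx n k, ∀ t ∈ Set.Icc (0 : ℝ) 1,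
      HasDerivWithinAt (fun t => (γ t).2 J) ((velocity γ t).2 J) (Set.Icc 0 1) t :=
    fun J t ht => hasDerivWithinAt_pi.1 (hd t ht).snd J
  -- A function vanishing at time `0` with derivative at most `K` times the speed is at most `K s`.
  have cmp : ∀ (f f' : ℝ → ℝ) (K : ℝ),
      (∀ t ∈ Set.Icc (0 : ℝ) 1, HasDerivWithinAt f (f' t) (Set.Icc 0 1) t) → f 0 = 0 →
      (∀ t ∈ Set.Icc (0 : ℝ) 1, |f' t| ≤ K * speed (γ t) (velocity γ t)) →
      ∀ t ∈ Set.Icc (0 : ℝ) 1, |f t| ≤ K * s t := by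
    intro f f' K hf hf0 hK t ht
    refine image_norm_le_of_norm_deriv_right_le_deriv_boundary (f := f) (f' := f')
      (B := fun t => K * s t) (B' := fun t => K * g t)
      (fun t ht => (hf t ht).continuousWithinAt) (fun t ht => ?_) ?_
      (fun t => (sd t).const_mul K) (fun t ht => ?_) ht
    · exact (hf t ⟨ht.1, ht.2.le⟩).mono_of_mem_nhdsWithin (Icc_mem_nhdsGE_of_mem ht)
    · simp [hf0, s0]
    · have ht' : t ∈ Set.Icc (0 : ℝ) 1 := ⟨ht.1, ht.2.le⟩
      simp only [geq t ht']
      exact hK t ht'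
  have one_mem : (1 : ℝ) ∈ Set.Icc (0 : ℝ) 1 := ⟨zero_le_one, le_rfl⟩
  constructor
  · intro i
    have := cmp (fun t => (γ t).1 i - p.1 i) (fun t => (velocity γ t).1 i) 1
      (fun t ht => (hasDerivWithinAt_pi.1 (hd1 t ht) i).sub_const _) (by simp [h.source])
      (fun t ht => by rw [one_mul]; exact abs_fst_le_speed _ _ _) 1 one_mem
    simpa only [h.target, one_mul, s1] using this
  · have key : ∀ m : ℕ, ∀ J : MultiIdx n k, J.deg + m = k → ∀ t ∈ Set.Icc (0 : ℝ) 1,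
        |(γ t).2 J - multiDeriv J.1 (taylor p) (γ t).1| ≤ n ^ m * length γ ^ m * s t := by
      intro m
      induction m with
      | zero =>
        intro J hJ
        have hJk : ¬ J.deg < k := by omega
        refine cmp _ (fun t => (velocity γ t).2 J - ∑ i, (velocity γ t).1 i *
            partialDeriv i (multiDeriv J.1 (taylor p)) (γ t).1) _
          (fun t ht => (hd2 J t ht).sub
            (((smooth_taylor p).listDeriv (dirList J.1)).hasDerivWithinAt_comp (hd1 t ht)))
          ?_ ?_
        · simp only [h.source, multiDeriv_taylor_self, sub_self]
        · intro t ht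
          have hz : ∀ i, partialDeriv i (multiDeriv J.1 (taylor p)) = 0 := fun i =>
            listDeriv_taylor_eq_zero p (l := i :: dirList J.1) (by
              have : ∑ i, J.1 i = k := by simpa [MultiIdx.deg] using hJ
              simp [length_dirList, this])
          have := abs_coeffU_le_speed (γ t) (velocity γ t) J
          simp only [coeffU, fieldX_of_deg_eq _ _ hJk] at this
          simpa [hz] using this
      | succ m ih =>
        intro J hJ
        have hJk : J.deg < k := by omega
        refine cmp _ (fun t => (velocity γ t).2 J - ∑ i, (velocity γ t).1 i *
            partialDeriv i (multiDeriv J.1 (taylor p)) (γ t).1) _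
          (fun t ht => (hd2 J t ht).sub
            (((smooth_taylor p).listDeriv (dirList J.1)).hasDerivWithinAt_comp (hd1 t ht)))
          ?_ ?_
        · simp only [h.source, multiDeriv_taylor_self, sub_self]
        · intro t ht
          have h0 := (mem_horizontal_iff _ _).1 (h.velocity_mem t ht) J hJk
          rw [coeffU, sub_eq_zero] at h0
          have hadd : ∀ i, (J.addSingle i hJk).deg + m = k := by
            intro i
            have : (J.addSingle i hJk).deg = J.deg + 1 := by
              simp [MultiIdx.deg, MultiIdx.addSingle, Finset.sum_add_distrib]
            omega
          have e : (velocity γ t).2 J - ∑ i, (velocity γ t).1 i *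
              partialDeriv i (multiDeriv J.1 (taylor p)) (γ t).1 =
              ∑ i, (velocity γ t).1 i * ((γ t).2 (J.addSingle i hJk) -
                multiDeriv (J.addSingle i hJk).1 (taylor p) (γ t).1) := by
            rw [h0, ← Finset.sum_sub_distrib]
            refine Finset.sum_congr rfl fun i _ => ?_
            rw [partialDeriv_multiDeriv (smooth_taylor p)]
            simp [fieldX, hJk, MultiIdx.addSingle]
            ring
          rw [e]
          refine (Finset.abs_sum_le_sum_abs _ _).trans ?_
          calc _ ≤ ∑ _i : Fin n, speed (γ t) (velocity γ t) *
                (n ^ m * length γ ^ m * length γ) := by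
                refine Finset.sum_le_sum fun i _ => ?_
                rw [abs_mul]
                refine mul_le_mul (abs_fst_le_speed _ _ _) ((ih _ (hadd i) t ht).trans ?_)
                  (abs_nonneg _) (speed_nonneg _ _)
                gcongr
                exact sle t ht
            _ = _ := by simp; ring
    intro J
    have hJ : J.deg + (k - J.deg) = k := Nat.add_sub_cancel' J.sum_le
    have := key _ J hJ 1 one_mem
    rw [h.target, s1] at this
    calc _ ≤ _ := this
      _ = _ := by ring

theorem norm_fst_sub_le_of_ccDist_lt {p q : JetSpace n k} {ρ : ℝ} (hρ : 0 ≤ ρ)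
    (h : ccDist p q < ENNReal.ofReal ρ) :
    ‖q.1 - p.1‖ ≤ ρ ∧ ∀ J : MultiIdx n k, |q.2 J - multiDeriv J.1 (taylor p) q.1| ≤
        n ^ (k - J.deg) * ρ ^ (k - J.deg + 1) := by
  obtain ⟨γ, hγ⟩ := iInf_lt_iff.1 h
  obtain ⟨hγ', hlt⟩ := iInf_lt_iff.1 hγ
  have hℓ : length γ ≤ ρ := (ENNReal.ofReal_le_ofReal_iff hρ).1 hlt.le
  have hl : 0 ≤ length γ :=
    intervalIntegral.integral_nonneg zero_le_one fun t _ => Real.sqrt_nonneg _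
  obtain ⟨h1, h2⟩ := hγ'.abs_sub_taylor_le
  refine ⟨(pi_norm_le_iff_of_nonneg hρ).2 fun i => (h1 i).trans hℓ, fun J => (h2 J).trans ?_⟩
  gcongr

theorem edist_fst_le_ccDist (p q : JetSpace n k) : edist p.1 q.1 ≤ ccDist p q := by
  refine le_iInf₂ fun γ hγ => ?_
  have hl : 0 ≤ length γ :=
    intervalIntegral.integral_nonneg zero_le_one fun t _ => Real.sqrt_nonneg _
  rw [edist_dist, dist_comm, dist_eq_norm]
  refine ENNReal.ofReal_le_ofReal ?_
  exact (pi_norm_le_iff_of_nonneg hl).2 fun i => hγ.abs_sub_taylor_le.1 i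

/-- Two jets whose Taylor polynomials are close at scale `ρ` are at distance `O(ρ)`: the jets of
`T_p + Φ (T_q - T_p)`, with `Φ` a cutoff rising from `0` to `1`, lead from `T_p` to `q`.  The cutoff
needs room, so the curve first follows the jets of `T_p` to a base point at distance `ρ` from that
of `q`. -/
theorem ccDist_le_of_taylor_close (hn : 1 ≤ n) (R K : ℝ) (hR : 0 ≤ R) (hK : 0 ≤ K) :
    ∃ C : ℝ, 0 ≤ C ∧ ∀ (p q : JetSpace n k) (ρ : ℝ), 0 < ρ → ‖q.1 - p.1‖ ≤ R * ρ →
      (∀ J : MultiIdx n k, |q.2 J - multiDeriv J.1 (taylor p) q.1| * ρ ^ J.deg ≤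
        K * ρ ^ (k + 1)) →
      ccDist p q ≤ ENNReal.ofReal (C * ρ) := by
  obtain ⟨C₀, hC₀, hcut⟩ := derivBound_cutoff (n := n) (k + 1)
  set A : ℝ := (1 + n * 1) ^ (k + 1) * K with hA
  set M : ℝ := 2 ^ (k + 1) * (3 ^ (k + 1) * C₀ * A) with hM
  have hA0 : 0 ≤ A := by positivity
  have hM0 : 0 ≤ M := by positivity
  set N : ℝ := n + Fintype.card (MultiIdx n k) * (n * M) with hN
  have hN0 : 0 ≤ N := by positivity
  refine ⟨n * (R + 1) + N, by positivity, fun p q ρ hρ hx hJ => ?_⟩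
  set i₀ : Fin n := ⟨0, hn⟩ with hi₀
  set xm : Fin n → ℝ := q.1 - Pi.single i₀ ρ with hxm
  have nsingle : ‖(Pi.single i₀ ρ : Fin n → ℝ)‖ = ρ := by
    rw [Pi.norm_single, Real.norm_of_nonneg hρ.le]
  have step1 : ccDist p (jet k (taylor p) xm) ≤ ENNReal.ofReal (n * (R + 1) * ρ) := by
    have := ccDist_jet_le (k := k) (smooth_taylor p) convex_univ (M := 0)
      (fun l hl y _ => by rw [listDeriv_taylor_eq_zero p (by omega)]; simp)
      (Set.mem_univ p.1) (Set.mem_univ xm)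
    rw [jet_taylor] at this
    refine this.trans (ENNReal.ofReal_le_ofReal ?_)
    have h1 : ‖xm - p.1‖ ≤ R * ρ + ρ := by
      have : xm - p.1 = (q.1 - p.1) - Pi.single i₀ ρ := by rw [hxm]; abel
      rw [this]
      exact (norm_sub_le _ _).trans (by rw [nsingle]; linarith)
    simp only [mul_zero, add_zero]
    calc n * ‖xm - p.1‖ ≤ n * (R * ρ + ρ) := by gcongr
      _ = _ := by ring
  -- The affine function `3 (y - x_m)_{i₀} / ρ - 1` is `-1` at `x_m` and `2` at the end point.
  set Φ := cutoff (Pi.single i₀ (3 / ρ)) (-(3 / ρ * xm i₀) - 1) with hΦ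
  have hval : ∀ y : Fin n → ℝ, ∑ i, (Pi.single i₀ (3 / ρ) : Fin n → ℝ) i * y i +
      (-(3 / ρ * xm i₀) - 1) = 3 / ρ * (y i₀ - xm i₀) - 1 := by
    intro y
    simp [Pi.single_apply]
    ring
  set P := taylor q - taylor p with hP
  have sP : Smooth P := (smooth_taylor q).sub (smooth_taylor p)
  have sΦ : Smooth Φ := smooth_cutoff _ _
  have sΦP : Smooth (Φ * P) := sΦ.mul sP
  have zP : ∀ l : List (Fin n), l.length = k + 1 → listDeriv l P = 0 := by
    intro l hl
    rw [hP, listDeriv_sub (smooth_taylor q) (smooth_taylor p),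
      listDeriv_taylor_eq_zero p (by omega), listDeriv_taylor_eq_zero q (by omega), sub_zero]
  have bP : DerivBound (k + 1) ρ (Metric.closedBall q.1 (1 * ρ)) (A * ρ ^ (k + 1)) P := by
    have := derivBound_of_jet_bound sP zP hρ zero_le_one (E := K * ρ ^ (k + 1)) (by positivity)
      (x₀ := q.1) (fun l hl => by
        have hc : ∑ i, l.count i = l.length := by
          simpa using Multiset.sum_count_eq_card (s := Finset.univ) (m := (l : Multiset (Fin n)))
            (by simp)
        let J : MultiIdx n k := ⟨fun i => l.count i, (MultiIdx.mem_iff _).2 (by omega)⟩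
        have e : listDeriv l P q.1 = q.2 J - multiDeriv J.1 (taylor p) q.1 := by
          rw [hP, listDeriv_sub (smooth_taylor q) (smooth_taylor p), Pi.sub_apply,
            listDeriv_eq_multiDeriv (smooth_taylor q), listDeriv_eq_multiDeriv (smooth_taylor p)]
          rw [← multiDeriv_taylor_self q J]
        rw [e, ← hc]
        exact hJ J)
    rw [← mul_assoc] at this
    exact this
  have bΦ : DerivBound (k + 1) ρ (Metric.closedBall q.1 (1 * ρ)) (3 ^ (k + 1) * C₀) Φ := by
    intro l hl y _
    refine hcut _ _ ρ 3 hρ.le (by norm_num) (fun i => ?_) l hl y (Set.mem_univ y)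
    by_cases hi : i = i₀
    · subst hi
      rw [Pi.single_eq_same, abs_of_pos (by positivity)]
      exact le_of_eq (by field_simp)
    · simp [hi]
  have bΦP := DerivBound.mul hρ.le sΦ sP bΦ bP
  have sG : Smooth (taylor p + Φ * P) := (smooth_taylor p).add sΦP
  have step2 : ccDist (jet k (taylor p) xm) q ≤ ENNReal.ofReal (N * ρ) := by
    have := ccDist_jet_le (k := k) sG (convex_closedBall q.1 (1 * ρ)) (M := M) (fun l hl y hy => by
        rw [listDeriv_add (smooth_taylor p) sΦP, listDeriv_taylor_eq_zero p (by omega), zero_add]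
        have h1 := bΦP l hl.le y hy
        rw [hl] at h1
        have h2 : 0 < ρ ^ (k + 1) := by positivity
        refine le_of_mul_le_mul_right (h1.trans (le_of_eq ?_)) h2
        rw [hM]; ring)
      (y := xm) (y' := q.1)
      (by
        rw [Metric.mem_closedBall, dist_eq_norm, hxm, sub_sub_cancel_left, norm_neg, nsingle]
        linarith)
      (Metric.mem_closedBall_self (by linarith))
    have e1 : jet k (taylor p + Φ * P) xm = jet k (taylor p) xm := by
      refine jet_congr ?_
      have := cutoff_eventuallyEq_zero (a := Pi.single i₀ (3 / ρ)) (b := -(3 / ρ * xm i₀) - 1)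
        (y := xm) (by rw [hval]; simp)
      filter_upwards [this] with z hz
      simp only [Pi.add_apply, Pi.mul_apply, hΦ, hz]
      simp
    have e2 : jet k (taylor p + Φ * P) q.1 = q := by
      have := cutoff_eventuallyEq_one (a := Pi.single i₀ (3 / ρ)) (b := -(3 / ρ * xm i₀) - 1)
        (y := q.1) (by
          rw [hval, hxm]
          simp only [Pi.sub_apply, Pi.single_eq_same, sub_sub_cancel]
          rw [div_mul_cancel₀ _ hρ.ne']
          norm_num)
      conv_rhs => rw [← jet_taylor q]
      refine jet_congr ?_
      filter_upwards [this] with z hz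
      simp only [Pi.add_apply, Pi.mul_apply, hΦ, hz]
      simp [hP]
    rw [e1, e2] at this
    have e3 : ‖q.1 - xm‖ = ρ := by rw [hxm, sub_sub_cancel, nsingle]
    rwa [e3] at this
  calc ccDist p q ≤ _ := ccDist_triangle p (jet k (taylor p) xm) q
    _ ≤ ENNReal.ofReal (n * (R + 1) * ρ) + ENNReal.ofReal (N * ρ) := add_le_add step1 step2
    _ = _ := by
      rw [← ENNReal.ofReal_add (by positivity) (by positivity)]
      congr 1
      ring

/-! ### Blending Taylor polynomials -/

/-- Starting from the function `R`, successively blend in the functions `T v`, for `v` running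
through the list from its end to its head: in each step the current function `G` becomes
`(1 - Ψ v) G + Ψ v T v`. -/
def blend {V : Type*} (Ψ T : V → (Fin n → ℝ) → ℝ) (R : (Fin n → ℝ) → ℝ) :
    List V → (Fin n → ℝ) → ℝ
  | [] => R
  | v :: l => blend Ψ T R l + Ψ v * (T v - blend Ψ T R l)

section Blend

variable {V : Type*} {Ψ T : V → (Fin n → ℝ) → ℝ} {R : (Fin n → ℝ) → ℝ}

theorem smooth_blend (hΨ : ∀ v, Smooth (Ψ v)) (hT : ∀ v, Smooth (T v)) (hR : Smooth R)
    (l : List V) : Smooth (blend Ψ T R l) := by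
  induction l with
  | nil => exact hR
  | cons v l ih => exact ih.add ((hΨ v).mul ((hT v).sub ih))

theorem blend_eventuallyEq_filter {y : Fin n → ℝ} (p : V → Bool) (l : List V)
    (h : ∀ v ∈ l, p v = false → Ψ v =ᶠ[nhds y] 0) :
    blend Ψ T R l =ᶠ[nhds y] blend Ψ T R (l.filter p) := by
  induction l with
  | nil => rfl
  | cons v l ih =>
    have ih := ih fun w hw => h w (List.mem_cons_of_mem _ hw)
    cases hv : p v with
    | false =>
      rw [List.filter_cons_of_neg (by simp [hv])]
      filter_upwards [ih, h v List.mem_cons_self hv] with z h1 h2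
      simp [blend, h1, h2]
    | true =>
      rw [List.filter_cons_of_pos hv]
      filter_upwards [ih] with z h1
      simp [blend, h1]

/-- Where one of the weights is equal to `1`, the initial function is forgotten. -/
theorem blend_eventuallyEq_of_weight_eq_one {R' : (Fin n → ℝ) → ℝ} {y : Fin n → ℝ} (l : List V)
    (h : ∃ v ∈ l, Ψ v =ᶠ[nhds y] 1) : blend Ψ T R l =ᶠ[nhds y] blend Ψ T R' l := by
  induction l with
  | nil => simp at h
  | cons v l ih =>
    obtain ⟨w, hw, hw1⟩ := h
    rcases List.mem_cons.1 hw with rfl | hw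
    · filter_upwards [hw1] with z hz
      simp [blend, hz]
    · filter_upwards [ih ⟨w, hw, hw1⟩] with z hz
      simp [blend, hz]

theorem derivBound_blend_sub {N : ℕ} {ρ : ℝ} {U : Set (Fin n → ℝ)} {C E : ℝ} (hρ : 0 ≤ ρ)
    (hΨ : ∀ v, Smooth (Ψ v)) (hT : ∀ v, Smooth (T v)) (hR : Smooth R)
    (l : List V) (bΨ : ∀ v ∈ l, DerivBound N ρ U C (Ψ v))
    (bT : ∀ v ∈ l, DerivBound N ρ U E (T v - R)) :
    DerivBound N ρ U (((1 + 2 ^ N * C) ^ l.length - 1) * E) (blend Ψ T R l - R) := by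
  induction l with
  | nil =>
    intro l _ y _
    simp only [blend, listDeriv_sub hR hR]
    simp
  | cons v l ih =>
    have ih := ih (fun w hw => bΨ w (List.mem_cons_of_mem _ hw))
      (fun w hw => bT w (List.mem_cons_of_mem _ hw))
    have sG : Smooth (blend Ψ T R l - R) := (smooth_blend hΨ hT hR l).sub hR
    have sT : Smooth (T v - R) := (hT v).sub hR
    have e : blend Ψ T R (v :: l) - R =
        (blend Ψ T R l - R) + Ψ v * ((T v - R) - (blend Ψ T R l - R)) := by
      simp only [blend]; ring
    have sTG : Smooth ((T v - R) - (blend Ψ T R l - R)) := sT.sub sG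
    have sP : Smooth (Ψ v * ((T v - R) - (blend Ψ T R l - R))) := (hΨ v).mul sTG
    rw [e]
    have b1 := DerivBound.sub hρ sT sG (bT v List.mem_cons_self) ih
    have b2 := DerivBound.mul hρ (hΨ v) sTG (bΨ v List.mem_cons_self) b1
    refine (DerivBound.add hρ sG sP ih b2).mono (le_of_eq ?_)
    rw [List.length_cons, pow_succ]
    ring

end Blend

/-- Taylor polynomials of nearby jets are close, with all derivatives. -/
theorem derivBound_taylor_sub (hn : 1 ≤ n) {p q : JetSpace n k} {κ ρ R : ℝ} (hκ : 1 ≤ κ)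
    (hρ : 0 < ρ) (hR : 0 ≤ R) (h : ccDist p q < ENNReal.ofReal (κ * ρ)) :
    DerivBound (k + 1) ρ (Metric.closedBall q.1 (R * ρ))
      ((1 + n * R) ^ (k + 1) * ((n * κ) ^ (k + 1) * ρ ^ (k + 1))) (taylor p - taylor q) := by
  have hn' : (1 : ℝ) ≤ n := by exact_mod_cast hn
  have hnκ : 1 ≤ n * κ := by nlinarith
  have sP : Smooth (taylor p - taylor q) := (smooth_taylor p).sub (smooth_taylor q)
  refine derivBound_of_jet_bound sP (fun l hl => ?_) hρ hR (by positivity) (fun l hl => ?_)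
  · rw [listDeriv_sub (smooth_taylor p) (smooth_taylor q),
      listDeriv_taylor_eq_zero p (by omega), listDeriv_taylor_eq_zero q (by omega), sub_zero]
  · have hc : ∑ i, l.count i = l.length := by
      simpa using Multiset.sum_count_eq_card (s := Finset.univ) (m := (l : Multiset (Fin n)))
        (by simp)
    let J : MultiIdx n k := ⟨fun i => l.count i, (MultiIdx.mem_iff _).2 (by omega)⟩
    have hJ : J.deg = l.length := hc
    have e : listDeriv l (taylor p - taylor q) q.1 =
        -(q.2 J - multiDeriv J.1 (taylor p) q.1) := by
      rw [listDeriv_sub (smooth_taylor p) (smooth_taylor q), Pi.sub_apply,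
        listDeriv_eq_multiDeriv (smooth_taylor q), listDeriv_eq_multiDeriv (smooth_taylor p),
        ← multiDeriv_taylor_self q J]
      ring
    rw [e, abs_neg]
    have h1 := (norm_fst_sub_le_of_ccDist_lt (by positivity) h).2 J
    rw [hJ] at h1
    calc |q.2 J - multiDeriv J.1 (taylor p) q.1| * ρ ^ l.length
        ≤ (n ^ (k - l.length) * (κ * ρ) ^ (k - l.length + 1)) * ρ ^ l.length := by gcongr
      _ ≤ (n ^ (k - l.length + 1) * (κ * ρ) ^ (k - l.length + 1)) * ρ ^ l.length := by
          gcongr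
          omega
      _ = (n * κ) ^ (k - l.length + 1) * ρ ^ (k + 1) := by
          have : ρ ^ (k + 1) = ρ ^ (k - l.length + 1) * ρ ^ l.length := by
            rw [← pow_add]
            congr 1
            omega
          rw [this]
          simp only [mul_pow]
          ring
      _ ≤ (n * κ) ^ (k + 1) * ρ ^ (k + 1) := by
          gcongr
          omega

/-! ### The model simplex -/

/-- The vertices of a simplex in `ℝⁿ` around the origin: `(-1, …, -1)` and the standard basis. -/
def simplexVertex (j : Fin (n + 1)) : Fin n → ℝ :=
  Fin.cases (fun _ => -1) (fun i => Pi.single i 1) j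

/-- The coefficients of linear forms, one for each vertex of the model simplex, with value `n` at
their own vertex and `-1` at the others. -/
def simplexForm (j : Fin (n + 1)) : Fin n → ℝ :=
  Fin.cases (fun _ => -1) (fun i l => (if l = i then (n + 1 : ℝ) else 0) - 1) j

theorem simplexForm_vertex (j l : Fin (n + 1)) :
    ∑ i, simplexForm j i * simplexVertex l i = (if l = j then (n + 1 : ℝ) else 0) - 1 := by
  refine Fin.cases ?_ (fun j => ?_) j <;> refine Fin.cases ?_ (fun l => ?_) l
  · simp [simplexForm, simplexVertex]
  · simp [simplexForm, simplexVertex, Pi.single_apply, Fin.succ_ne_zero]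
  · simp [simplexForm, simplexVertex, (Fin.succ_ne_zero j).symm, Finset.sum_sub_distrib]
  · simp [simplexForm, simplexVertex, Pi.single_apply]

theorem norm_simplexVertex_le (j : Fin (n + 1)) : ‖(simplexVertex j : Fin n → ℝ)‖ ≤ 1 := by
  refine (pi_norm_le_iff_of_nonneg zero_le_one).2 fun i => ?_
  refine Fin.cases ?_ (fun j => ?_) j
  · simp [simplexVertex]
  · simp only [simplexVertex, Fin.cases_succ, Pi.single_apply]
    split_ifs <;> simp

theorem abs_simplexForm_le (j : Fin (n + 1)) (i : Fin n) : |simplexForm j i| ≤ n + 1 := by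
  have hn : (0 : ℝ) ≤ n := Nat.cast_nonneg n
  refine Fin.cases ?_ (fun j => ?_) j
  · simp [simplexForm]
  · simp only [simplexForm, Fin.cases_succ]
    split_ifs
    · rw [abs_le]; constructor <;> linarith
    · simp

theorem abs_simplexForm_sum_le (j : Fin (n + 1)) (w : Fin n → ℝ) :
    |∑ i, simplexForm j i * w i| ≤ n * (n + 1) * ‖w‖ := by
  refine (Finset.abs_sum_le_sum_abs _ _).trans ?_
  calc ∑ i, |simplexForm j i * w i| ≤ ∑ _i : Fin n, (n + 1) * ‖w‖ := by
        refine Finset.sum_le_sum fun i _ => ?_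
        rw [abs_mul]
        exact mul_le_mul (abs_simplexForm_le j i) (norm_le_pi_norm w i) (abs_nonneg _)
          (by positivity)
    _ = _ := by simp; ring

end JetSpace

/-! ### Coloured bump functions from a covering of bounded multiplicity -/

/-- Bump functions `b v` on the complement of `Z`, coloured by `Fin (n + 1)`, such that two bumps
of the same colour have disjoint supports.  On the support of `b v`, the distance to `Z`
is comparable to `radius v`, and `center v` is an almost nearest point of `Z`; nothing is said about
bumps that vanish identically. -/
structure ColoredBumps {X : Type*} [MetricSpace X] (Z : Set X) (n : ℕ) (c K : ℝ) (V : Type*) where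
  /-- the bump functions -/
  b : V → X → ℝ
  /-- the colours -/
  color : V → Fin (n + 1)
  /-- a nearby point of `Z` -/
  center : V → Z
  /-- the size of the support -/
  radius : V → ℝ
  nonneg : ∀ v x, 0 ≤ b v x
  le_infDist : ∀ v x, b v x ≤ Metric.infDist x Z
  lipschitz : ∀ v x x', |b v x - b v x'| ≤ 4 * dist x x'
  eq_of_color_eq : ∀ x ∉ Z, ∀ v w, 0 < b v x → 0 < b w x → color v = color w → v = w
  exists_large : ∀ x ∉ Z, ∃ v, c * Metric.infDist x Z ≤ b v x
  dist_center : ∀ x ∉ Z, ∀ v, 0 < b v x → dist x (center v) ≤ K * Metric.infDist x Z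
  radius_le : ∀ x ∉ Z, ∀ v, 0 < b v x → radius v ≤ K * Metric.infDist x Z
  le_radius : ∀ x ∉ Z, ∀ v, 0 < b v x → Metric.infDist x Z ≤ K * radius v

section Covering

variable {X : Type*} [MetricSpace X] {Z : Set X} {ι : Type*}

/-- The height of the point `x` in the neighbourhood of size `δ d(x, Z)` of the set `B i`.  Empty
members of the family are singled out because `infDist x ∅ = 0`. -/
def coverHeight (Z : Set X) (B : ι → Set X) (δ : ℝ) (i : ι) (x : X) : ℝ :=
  open Classical in
  if (B i).Nonempty then max 0 (δ * Metric.infDist x Z - Metric.infDist x (B i)) else 0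

theorem coverHeight_nonneg (B : ι → Set X) (δ : ℝ) (i : ι) (x : X) :
    0 ≤ coverHeight Z B δ i x := by
  unfold coverHeight
  split_ifs
  · exact le_max_left _ _
  · exact le_rfl

theorem coverHeight_le (B : ι → Set X) {δ : ℝ} (hδ : 0 ≤ δ) (i : ι) (x : X) :
    coverHeight Z B δ i x ≤ δ * Metric.infDist x Z := by
  have h := mul_nonneg hδ (Metric.infDist_nonneg (x := x) (s := Z))
  unfold coverHeight
  split_ifs
  · exact max_le h (sub_le_self _ Metric.infDist_nonneg)
  · exact h

theorem coverHeight_of_mem {B : ι → Set X} {δ : ℝ} (hδ : 0 ≤ δ) {i : ι} {x : X} (hx : x ∈ B i) :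
    coverHeight Z B δ i x = δ * Metric.infDist x Z := by
  rw [coverHeight, if_pos ⟨x, hx⟩, Metric.infDist_zero_of_mem hx, sub_zero,
    max_eq_right (mul_nonneg hδ Metric.infDist_nonneg)]

theorem exists_mem_of_coverHeight_pos {B : ι → Set X} {δ : ℝ} {i : ι} {x : X}
    (h : 0 < coverHeight Z B δ i x) : ∃ a ∈ B i, dist x a < δ * Metric.infDist x Z := by
  unfold coverHeight at h
  split_ifs at h with hB
  · have : Metric.infDist x (B i) < δ * Metric.infDist x Z := by
      rcases lt_max_iff.1 h with h | h
      · exact absurd h (lt_irrefl _)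
      · linarith
    exact (Metric.infDist_lt_iff hB).1 this
  · exact absurd h (lt_irrefl _)

theorem coverHeight_le_add (B : ι → Set X) {δ : ℝ} (hδ : 0 ≤ δ) (hδ1 : δ ≤ 1) (i : ι) (x x' : X) :
    coverHeight Z B δ i x ≤ coverHeight Z B δ i x' + 2 * dist x x' := by
  have hd := dist_nonneg (x := x) (y := x')
  unfold coverHeight
  split_ifs
  · refine max_le (add_nonneg (le_max_left _ _) (by positivity)) ?_
    have h1 := Metric.infDist_le_infDist_add_dist (s := Z) (x := x) (y := x')
    have h2 := Metric.infDist_le_infDist_add_dist (s := B i) (x := x') (y := x)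
    rw [dist_comm] at h2
    have h3 := le_max_right 0 (δ * Metric.infDist x' Z - Metric.infDist x' (B i))
    have h4 := mul_le_mul_of_nonneg_left h1 hδ
    nlinarith
  · positivity

theorem setDist_le_infDist {A : Set X} {a : X} (ha : a ∈ A) (hZ : Z.Nonempty) :
    setDist A Z ≤ ENNReal.ofReal (Metric.infDist a Z) := by
  rw [Metric.infDist, ENNReal.ofReal_toReal (Metric.infEDist_ne_top hZ)]
  exact iInf₂_le a ha

/-- At most `N` of the sets `B i` come close to a given point, if every small set meets at most
`N` of them. -/
theorem card_le_of_coverHeight_pos {B : ι → Set X} (hB : ∀ i, B i ⊆ Zᶜ)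
    {β δ : ℝ} (hβ : 0 ≤ β) (hδ2 : 2 * δ ≤ β * (1 - δ)) {N : ℕ}
    (hmult : ∀ D : Set X, D ⊆ Zᶜ → Metric.ediam D ≤ ENNReal.ofReal β * setDist D Z →
      {i | (D ∩ B i).Nonempty}.encard ≤ N) (x : X) (J : Finset ι)
    (hJ : ∀ i ∈ J, 0 < coverHeight Z B δ i x) : J.card ≤ N := by
  have hJ' : ∀ i ∈ J, ∃ a ∈ B i, dist x a < δ * Metric.infDist x Z := fun i hi =>
    exists_mem_of_coverHeight_pos (hJ i hi)
  have : Nonempty X := ⟨x⟩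
  choose! a haB had using hJ'
  have h0 := Metric.infDist_nonneg (x := x) (s := Z)
  have hsub : (a '' (J : Set ι)) ⊆ Zᶜ := by
    rintro _ ⟨i, hi, rfl⟩
    exact hB i (haB i hi)
  have hdiam : Metric.ediam (a '' (J : Set ι)) ≤ ENNReal.ofReal β * setDist (a '' (J : Set ι)) Z := by
    have h1 : Metric.ediam (a '' (J : Set ι)) ≤ ENNReal.ofReal (2 * δ * Metric.infDist x Z) := by
      refine Metric.ediam_le ?_
      rintro _ ⟨i, hi, rfl⟩ _ ⟨j, hj, rfl⟩
      rw [edist_dist]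
      refine ENNReal.ofReal_le_ofReal ?_
      have := dist_triangle_left (a i) (a j) x
      have := had i hi
      have := had j hj
      linarith
    have h2 : ENNReal.ofReal ((1 - δ) * Metric.infDist x Z) ≤ setDist (a '' (J : Set ι)) Z := by
      refine le_iInf₂ fun _ ⟨i, hi, e⟩ => le_iInf₂ fun z hz => ?_
      subst e
      rw [edist_dist]
      refine ENNReal.ofReal_le_ofReal ?_
      have := Metric.infDist_le_dist_of_mem (x := x) hz
      have := dist_triangle x (a i) z
      have := had i hi
      linarith
    refine h1.trans (le_trans ?_ (mul_le_mul_right h2 _))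
    rw [← ENNReal.ofReal_mul hβ]
    refine ENNReal.ofReal_le_ofReal ?_
    calc 2 * δ * Metric.infDist x Z ≤ β * (1 - δ) * Metric.infDist x Z := by gcongr
      _ = _ := by ring
  have h := hmult _ hsub hdiam
  have h' : (J : Set ι).encard ≤ N := by
    refine (Set.encard_le_encard fun i hi => ?_).trans h
    exact ⟨a i, ⟨i, hi, rfl⟩, haB i hi⟩
  rw [Set.encard_coe_eq_coe_finsetCard] at h'
  exact_mod_cast h'

/-- The bump function of the finite set `A` of indices: by how much all the heights in `A` exceed
all the other heights.  These are, up to normalization, the barycentric coordinates in the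
barycentric subdivision of the nerve of the covering, where `A` is the barycentre of a simplex of
dimension `A.card - 1`.  When there is no index outside `A`, the supremum is `0`, as it should be
for nonnegative heights. -/
def flagBump (h : ι → ℝ) (A : Finset ι) (hA : A.Nonempty) : ℝ :=
  max 0 (A.inf' hA h - ⨆ i : {i // i ∉ A}, h i)

theorem flagBump_le_add {h h' : ι → ℝ} {A : Finset ι} (hA : A.Nonempty) {ε C : ℝ}
    (h0 : ∀ i, 0 ≤ h i) (hC : ∀ i, h i ≤ C)
    (h1 : ∀ i, h i ≤ h' i + ε) (h2 : ∀ i, h' i ≤ h i + ε) :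
    flagBump h A hA ≤ flagBump h' A hA + 2 * ε := by
  have hε : 0 ≤ ε := by
    obtain ⟨i, -⟩ := hA
    linarith [h1 i, h2 i]
  unfold flagBump
  refine max_le (add_nonneg (le_max_left _ _) (by positivity)) ?_
  have e1 : A.inf' hA h ≤ A.inf' hA h' + ε := by
    rw [← sub_le_iff_le_add]
    refine Finset.le_inf' _ _ fun i hi => ?_
    linarith [Finset.inf'_le h hi, h1 i]
  have e2 : (⨆ i : {i // i ∉ A}, h' i) ≤ (⨆ i : {i // i ∉ A}, h i) + ε := by
    refine Real.iSup_le (fun i => ?_) (add_nonneg (Real.iSup_nonneg fun i => h0 i) hε)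
    have := le_ciSup (f := fun i : {i // i ∉ A} => h i)
      ⟨C, by rintro _ ⟨i, rfl⟩; exact hC i⟩ i
    linarith [h2 i]
  have e3 := le_max_right 0 (A.inf' hA h' - ⨆ i : {i // i ∉ A}, h' i)
  linarith

theorem lt_of_flagBump_pos {h : ι → ℝ} {A : Finset ι} {hA : A.Nonempty} {C : ℝ}
    (hC : ∀ i, h i ≤ C) (hpos : 0 < flagBump h A hA) {i j : ι} (hi : i ∈ A) (hj : j ∉ A) :
    h j < h i := by
  have h1 : (⨆ i : {i // i ∉ A}, h i) < A.inf' hA h := by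
    rcases lt_max_iff.1 hpos with h | h
    · exact absurd h (lt_irrefl _)
    · linarith
  have := le_ciSup (f := fun i : {i // i ∉ A} => h i)
    ⟨C, by rintro _ ⟨i, rfl⟩; exact hC i⟩ ⟨j, hj⟩
  have := Finset.inf'_le h hi
  linarith

theorem pos_of_flagBump_pos {h : ι → ℝ} {A : Finset ι} {hA : A.Nonempty}
    (h0 : ∀ i, 0 ≤ h i) (hpos : 0 < flagBump h A hA) {i : ι} (hi : i ∈ A) : 0 < h i := by
  have h1 : (⨆ i : {i // i ∉ A}, h i) < A.inf' hA h := by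
    rcases lt_max_iff.1 hpos with h | h
    · exact absurd h (lt_irrefl _)
    · linarith
  have h2 : 0 ≤ ⨆ i : {i // i ∉ A}, h i := Real.iSup_nonneg fun i => h0 i
  exact (h2.trans_lt h1).trans_le (Finset.inf'_le h hi)

/-- Pigeonhole: among at most `n + 1` positive heights of which the largest is `(n + 1) s`, there
is a gap of length `s`. -/
theorem exists_flagBump_ge {h : ι → ℝ} (n : ℕ) {s : ℝ} (hs : 0 < s)
    (hcard : ∀ J : Finset ι, (∀ i ∈ J, 0 < h i) → J.card ≤ n + 1) {i₀ : ι}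
    (hi₀ : h i₀ = (n + 1) * s) : ∃ A, ∃ hA : A.Nonempty, s ≤ flagBump h A hA := by
  classical
  have hgap : ∃ m : Fin (n + 1), ∀ i, ¬ ((m : ℝ) * s < h i ∧ h i < (m + 1) * s) := by
    by_contra! hcon
    choose g hg1 hg2 using hcon
    have ginj : Function.Injective g := by
      have : ∀ a b : Fin (n + 1), g a = g b → (a : ℕ) ≤ b := by
        intro a b hab
        have h1 := hg1 a
        rw [hab] at h1
        have h2 : (a : ℝ) < b + 1 := lt_of_mul_lt_mul_right (h1.trans (hg2 b)) hs.le
        exact Nat.lt_succ_iff.1 (by exact_mod_cast h2)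
      exact fun a b hab => Fin.ext (le_antisymm (this a b hab) (this b a hab.symm))
    have hnot : i₀ ∉ Finset.univ.image g := by
      simp only [Finset.mem_image, Finset.mem_univ, true_and, not_exists]
      rintro m rfl
      have h1 := hg2 m
      rw [hi₀] at h1
      have h2 : (n : ℝ) + 1 < m + 1 := lt_of_mul_lt_mul_right h1 hs.le
      have h3 : n + 1 < (m : ℕ) + 1 := by exact_mod_cast h2
      omega
    have := hcard (insert i₀ (Finset.univ.image g)) (by
      intro i hi
      rcases Finset.mem_insert.1 hi with rfl | hi
      · rw [hi₀]; positivity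
      · obtain ⟨m, -, rfl⟩ := Finset.mem_image.1 hi
        exact lt_of_le_of_lt (by positivity) (hg1 m))
    rw [Finset.card_insert_of_notMem hnot, Finset.card_image_of_injective _ ginj,
      Finset.card_univ, Fintype.card_fin] at this
    omega
  obtain ⟨m, hm⟩ := hgap
  have hfin : {i | (m + 1) * s ≤ h i}.Finite := by
    by_contra hinf
    obtain ⟨J, hJ, hJc⟩ := Set.Infinite.exists_subset_card_eq hinf (n + 2)
    have := hcard J fun i hi => lt_of_lt_of_le (by positivity) (hJ hi)
    omega
  have hmem : ∀ i, i ∈ hfin.toFinset ↔ (m + 1) * s ≤ h i := fun i => by simp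
  have hmn : (m : ℝ) ≤ n := by exact_mod_cast Nat.lt_succ_iff.1 m.2
  refine ⟨hfin.toFinset, ⟨i₀, (hmem _).2 (by rw [hi₀]; gcongr)⟩, ?_⟩
  refine le_trans ?_ (le_max_right _ _)
  have e1 : (m + 1) * s ≤ hfin.toFinset.inf' ⟨i₀, (hmem _).2 (by rw [hi₀]; gcongr)⟩ h :=
    Finset.le_inf' _ _ fun i hi => (hmem i).1 hi
  have e2 : (⨆ i : {i // i ∉ hfin.toFinset}, h i) ≤ m * s := by
    refine Real.iSup_le (fun i => ?_) (by positivity)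
    have h1 := fun h' => i.2 ((hmem _).2 h')
    by_contra h2
    exact hm i ⟨not_le.1 h2, not_le.1 h1⟩
  linarith

theorem exists_coloredBumps (n : ℕ) {α β : ℝ} (hα : 0 < α) (hβ : 0 < β) :
    ∃ c K : ℝ, 0 < c ∧ 1 ≤ K ∧ ∀ (X : Type*) [MetricSpace X] (Z : Set X), Z.Nonempty → IsClosed Z →
      ∀ (ι : Type*) (B : ι → Set X),
        (∀ i, B i ⊆ Zᶜ) →
        Zᶜ ⊆ ⋃ i, B i →
        (∀ i, Metric.ediam (B i) ≤ ENNReal.ofReal α * setDist (B i) Z) →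
        (∀ D : Set X, D ⊆ Zᶜ → Metric.ediam D ≤ ENNReal.ofReal β * setDist D Z →
          {i | (D ∩ B i).Nonempty}.encard ≤ n + 1) →
        Nonempty (ColoredBumps Z n c K {A : Finset ι // A.Nonempty}) := by
  set δ : ℝ := min (1 / 2) (β / 4) with hδ
  have hδ0 : 0 < δ := lt_min (by norm_num) (by positivity)
  have hδh : δ ≤ 1 / 2 := min_le_left _ _
  have hδ1 : δ ≤ 1 := by linarith
  have hδβ : 2 * δ ≤ β * (1 - δ) := by
    have : δ ≤ β / 4 := min_le_right _ _
    nlinarith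
  refine ⟨δ / (n + 1), 5 + 6 * α, by positivity, by linarith, ?_⟩
  intro X _ Z hZ hZc ι B hB hcov hdiam hmult
  have hpos : ∀ x ∉ Z, 0 < Metric.infDist x Z := fun x hx =>
    (hZc.notMem_iff_infDist_pos hZ).1 hx
  have hBd : ∀ i, ∀ a ∈ B i, ∀ b ∈ B i, dist a b ≤ α * Metric.infDist a Z := by
    intro i a ha b hb
    have h1 := (Metric.edist_le_ediam_of_mem ha hb).trans ((hdiam i).trans
      (mul_le_mul_right (setDist_le_infDist ha hZ) _))
    rw [← ENNReal.ofReal_mul hα.le, edist_dist] at h1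
    exact (ENNReal.ofReal_le_ofReal_iff (mul_nonneg hα.le Metric.infDist_nonneg)).1 h1
  obtain ⟨z₀, hz₀⟩ := hZ
  have hZ : Z.Nonempty := ⟨z₀, hz₀⟩
  -- Each nonempty `B i` gets a base point and an almost nearest point of `Z`.
  have hch : ∀ i, ∃ (a : X) (z : Z), (B i).Nonempty →
      a ∈ B i ∧ dist a z ≤ 2 * Metric.infDist a Z := by
    intro i
    by_cases hi : (B i).Nonempty
    · obtain ⟨a, ha⟩ := hi
      have := hpos a (hB i ha)
      obtain ⟨z, hz, hlt⟩ := (Metric.infDist_lt_iff hZ (x := a)).1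
        (show Metric.infDist a Z < 2 * Metric.infDist a Z by linarith)
      exact ⟨a, ⟨z, hz⟩, fun _ => ⟨ha, hlt.le⟩⟩
    · exact ⟨z₀, ⟨z₀, hz₀⟩, fun h => absurd h hi⟩
  choose a z haz using hch
  set τ : X → ι → ℝ := fun x i => coverHeight Z B δ i x with hτ
  have τ0 : ∀ x i, 0 ≤ τ x i := fun x i => coverHeight_nonneg B δ i x
  have τle : ∀ x i, τ x i ≤ δ * Metric.infDist x Z := fun x i => coverHeight_le B hδ0.le i x
  have τlip : ∀ x x' i, τ x i ≤ τ x' i + 2 * dist x x' := fun x x' i =>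
    coverHeight_le_add B hδ0.le hδ1 i x x'
  have hcard : ∀ x, ∀ J : Finset ι, (∀ i ∈ J, 0 < τ x i) → J.card ≤ n + 1 := fun x J hJ =>
    card_le_of_coverHeight_pos hB hβ.le hδβ (N := n + 1) (by exact_mod_cast hmult) x J hJ
  have geom : ∀ x, ∀ A : {A : Finset ι // A.Nonempty}, 0 < flagBump (τ x) A.1 A.2 →
      dist x (z A.2.choose) ≤ (5 + 6 * α) * Metric.infDist x Z ∧
      Metric.infDist (a A.2.choose) Z ≤ (5 + 6 * α) * Metric.infDist x Z ∧
      Metric.infDist x Z ≤ (5 + 6 * α) * Metric.infDist (a A.2.choose) Z := by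
    intro x A hA
    set i := A.2.choose
    obtain ⟨b, hb, hxb⟩ := exists_mem_of_coverHeight_pos
      (pos_of_flagBump_pos (τ0 x) hA A.2.choose_spec)
    obtain ⟨ha, haz⟩ := haz i ⟨b, hb⟩
    have d0 := Metric.infDist_nonneg (x := x) (s := Z)
    have da := Metric.infDist_nonneg (x := a i) (s := Z)
    have h1 : dist x b ≤ 1 / 2 * Metric.infDist x Z := hxb.le.trans (by gcongr)
    have h2 := Metric.infDist_le_infDist_add_dist (s := Z) (x := b) (y := x)
    have h3 := Metric.infDist_le_infDist_add_dist (s := Z) (x := x) (y := b)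
    have h4 := Metric.infDist_le_infDist_add_dist (s := Z) (x := a i) (y := b)
    have h5 := Metric.infDist_le_infDist_add_dist (s := Z) (x := b) (y := a i)
    have h6 := hBd i _ ha _ hb
    have h7 := hBd i _ hb _ ha
    rw [dist_comm b x] at h2
    rw [dist_comm b (a i)] at h5 h7
    have h8 : α * Metric.infDist b Z ≤ α * (3 / 2 * Metric.infDist x Z) := by
      gcongr; linarith
    have h9 := dist_triangle4 x b (a i) (z i)
    rw [dist_comm b (a i)] at h9
    have h10 : 0 ≤ α * Metric.infDist x Z := by positivity
    have h11 : 0 ≤ α * Metric.infDist (a i) Z := by positivity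
    refine ⟨by nlinarith, by nlinarith, by nlinarith⟩
  have cardle : ∀ x, ∀ A : {A : Finset ι // A.Nonempty}, 0 < flagBump (τ x) A.1 A.2 →
      A.1.card ≤ n + 1 := fun x A hA =>
    hcard x A.1 fun i hi => pos_of_flagBump_pos (τ0 x) hA hi
  refine ⟨{
    b := fun A x => flagBump (τ x) A.1 A.2
    color := fun A => Fin.ofNat (n + 1) (A.1.card - 1)
    center := fun A => z A.2.choose
    radius := fun A => Metric.infDist (a A.2.choose) Z
    nonneg := fun A x => le_max_left _ _
    le_infDist := ?_
    lipschitz := ?_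
    eq_of_color_eq := ?_
    exists_large := ?_
    dist_center := fun x _ A hA => (geom x A hA).1
    radius_le := fun x _ A hA => (geom x A hA).2.1
    le_radius := fun x _ A hA => (geom x A hA).2.2 }⟩
  · intro A x
    have d0 := Metric.infDist_nonneg (x := x) (s := Z)
    refine max_le d0 ?_
    have h1 := Finset.inf'_le (τ x) A.2.choose_spec
    have h2 := τle x A.2.choose
    have h3 : 0 ≤ ⨆ i : {i // i ∉ A.1}, τ x i := Real.iSup_nonneg fun i => τ0 x i
    have h4 : δ * Metric.infDist x Z ≤ 1 * Metric.infDist x Z := by gcongr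
    linarith
  · have half : ∀ (A : {A : Finset ι // A.Nonempty}) (x x' : X),
        flagBump (τ x) A.1 A.2 ≤ flagBump (τ x') A.1 A.2 + 2 * (2 * dist x x') := fun A x x' =>
      flagBump_le_add A.2 (τ0 x) (τle x) (τlip x x')
        (fun i => by rw [dist_comm]; exact τlip x' x i)
    intro A x x'
    have h1 := half A x x'
    have h2 := half A x' x
    rw [dist_comm x' x] at h2
    rw [abs_le]
    constructor <;> linarith
  · intro x _ A A' hA hA' hc
    have c1 := cardle x A hA
    have c2 := cardle x A' hA'
    have p1 := A.2.card_pos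
    have p2 := A'.2.card_pos
    have hcard : A.1.card = A'.1.card := by
      have := congrArg Fin.val hc
      simp only [Fin.ofNat] at this
      rw [Nat.mod_eq_of_lt (by omega), Nat.mod_eq_of_lt (by omega)] at this
      omega
    by_contra hne
    have hne1 : ¬ A.1 ⊆ A'.1 := fun h =>
      hne (Subtype.ext (Finset.eq_of_subset_of_card_le h hcard.ge))
    have hne2 : ¬ A'.1 ⊆ A.1 := fun h =>
      hne (Subtype.ext (Finset.eq_of_subset_of_card_le h hcard.le).symm)
    obtain ⟨i, hi, hi'⟩ := Finset.not_subset.1 hne1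
    obtain ⟨j, hj, hj'⟩ := Finset.not_subset.1 hne2
    exact lt_asymm (lt_of_flagBump_pos (τle x) hA hi hj') (lt_of_flagBump_pos (τle x) hA' hj hi')
  · intro x hx
    have := hpos x hx
    obtain ⟨i₀, hi₀⟩ := Set.mem_iUnion.1 (hcov hx)
    obtain ⟨A, hA, h⟩ := exists_flagBump_ge (h := τ x) n
      (s := δ / (n + 1) * Metric.infDist x Z) (by positivity) (hcard x) (i₀ := i₀)
      (by rw [hτ]; simp only; rw [coverHeight_of_mem hδ0.le hi₀]; field_simp)
    exact ⟨⟨A, hA⟩, h⟩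

end Covering

open JetSpace

/-! ### The extension -/

namespace ColoredBumps

variable {X : Type*} [MetricSpace X] {Z : Set X} {n k : ℕ} {c K : ℝ} {V : Type*}

/-- The bump functions that are positive at `x` (a finite set for `x ∉ Z`). -/
def support (P : ColoredBumps Z n c K V) (x : X) : Finset V :=
  open Classical in if h : {v | 0 < P.b v x}.Finite then h.toFinset else ∅

theorem mem_support (P : ColoredBumps Z n c K V) {x : X} (hx : x ∉ Z) {v : V} :
    v ∈ P.support x ↔ 0 < P.b v x := by
  have hfin : {v | 0 < P.b v x}.Finite := by
    have : Finite {v | 0 < P.b v x} := Finite.of_injective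
      (fun v : {v | 0 < P.b v x} => P.color v.1)
      fun v w h => Subtype.ext (P.eq_of_color_eq x hx v.1 w.1 v.2 w.2 h)
    exact Set.toFinite _
  rw [support, dif_pos hfin, Set.Finite.mem_toFinset, Set.mem_ofPred_eq]

theorem card_support_le (P : ColoredBumps Z n c K V) {x : X} (hx : x ∉ Z) :
    (P.support x).card ≤ n + 1 := by
  have := Finset.card_le_card_of_injOn (s := P.support x) (t := Finset.univ) P.color
    (fun _ _ => Finset.mem_univ _) fun v hv w hw h =>
      P.eq_of_color_eq x hx v w ((P.mem_support hx).1 hv) ((P.mem_support hx).1 hw) h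
  simpa using this

theorem b_eq_zero (P : ColoredBumps Z n c K V) {x : X} (hx : x ∉ Z) {v : V}
    (hv : v ∉ P.support x) : P.b v x = 0 :=
  le_antisymm (not_lt.1 fun h => hv ((P.mem_support hx).2 h)) (P.nonneg v x)

/-- The position in `ℝⁿ` over which the jet at `x` lies: a Lipschitz extension `xhat` of the given
positions, displaced by an amount comparable to the distance from `Z`, towards the vertices of the
model simplex that correspond to the colours of the bumps at `x`. -/
def basePoint (P : ColoredBumps Z n c K V) (xhat : X → Fin n → ℝ) (L M : ℝ) (x : X) : Fin n → ℝ :=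
  xhat x + (M * L) • ∑ v ∈ P.support x, P.b v x • simplexVertex (P.color v)

/-- The cutoff function on `ℝⁿ` attached to the bump `v`: it depends on `v` only, and it detects
those base points near `v` at which the bump `v` is large in comparison with the other ones. -/
def weight (P : ColoredBumps Z n c K V) (f : Z → JetSpace n k) (L η : ℝ) (v : V) :
    (Fin n → ℝ) → ℝ :=
  cutoff (fun i => simplexForm (P.color v) i / (L * P.radius v))
    (η - ∑ i, simplexForm (P.color v) i / (L * P.radius v) * (f (P.center v)).1 i)

theorem smooth_weight (P : ColoredBumps Z n c K V) (f : Z → JetSpace n k) (L η : ℝ) (v : V) :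
    Smooth (P.weight f L η v) := smooth_cutoff _ _

/-- The function whose jet is used at `x`. -/
def germ [LinearOrder V] (P : ColoredBumps Z n c K V) (f : Z → JetSpace n k) (L η : ℝ) (x : X) :
    (Fin n → ℝ) → ℝ :=
  blend (P.weight f L η) (fun v => taylor (f (P.center v))) 0 (P.support x).sort

/-- The standing assumptions on the data of the construction: `xhat` extends the positions of `f`,
and the parameters `η` and `M` are large enough, in this order. -/
structure Admissible (P : ColoredBumps Z n c K V) (f : Z → JetSpace n k) (xhat : X → Fin n → ℝ)
    (L M η : ℝ) : Prop where
  isClosed : IsClosed Z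
  nonempty : Z.Nonempty
  one_le_n : 1 ≤ n
  c_pos : 0 < c
  one_le_K : 1 ≤ K
  L_pos : 0 < L
  M_nonneg : 0 ≤ M
  η_large : 4 * K ^ 2 * (n * (n + 1)) < η - 1
  M_large : 4 * K * (n * (n + 1) + η) < M * c
  lipschitz : ∀ z z' : Z, ccDist (f z) (f z') ≤ ENNReal.ofReal (L * dist z z')
  xhat_lipschitz : ∀ x x', ‖xhat x - xhat x'‖ ≤ L * dist x x'
  xhat_eq : ∀ z : Z, xhat z = (f z).1

/-- Two points are near if their distance is at most `ε` times their distances to `Z`. -/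
def Near (Z : Set X) (ε : ℝ) (x x' : X) : Prop :=
  dist x x' ≤ ε * Metric.infDist x Z ∧ dist x x' ≤ ε * Metric.infDist x' Z

theorem Near.symm {ε : ℝ} {x x' : X} (h : Near Z ε x x') : Near Z ε x' x :=
  ⟨by rw [dist_comm]; exact h.2, by rw [dist_comm]; exact h.1⟩

section

variable {P : ColoredBumps Z n c K V} {f : Z → JetSpace n k} {xhat : X → Fin n → ℝ} {L M η : ℝ}

theorem Admissible.infDist_pos (A : P.Admissible f xhat L M η) {x : X} (hx : x ∉ Z) :
    0 < Metric.infDist x Z :=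
  (A.isClosed.notMem_iff_infDist_pos A.nonempty).1 hx

theorem Admissible.geometry (A : P.Admissible f xhat L M η) {ε : ℝ} (hε : ε ≤ 1 / 2) {x x' : X}
    (hx : x ∉ Z) (hx' : x' ∉ Z) (h : Near Z ε x x') {v : V}
    (hv : v ∈ P.support x ∨ v ∈ P.support x') :
    dist x (P.center v) ≤ 2 * K * Metric.infDist x Z ∧
      P.radius v ≤ 2 * K * Metric.infDist x Z ∧ Metric.infDist x Z ≤ 2 * K * P.radius v := by
  have hd := A.infDist_pos hx
  have hd' := A.infDist_pos hx'
  have hK := A.one_le_K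
  have hKd : Metric.infDist x Z ≤ K * Metric.infDist x Z := le_mul_of_one_le_left hd.le hK
  rcases hv with hv | hv
  · rw [P.mem_support hx] at hv
    have h1 := P.dist_center x hx v hv
    have h2 := P.radius_le x hx v hv
    have h3 := P.le_radius x hx v hv
    refine ⟨by linarith, by linarith, by linarith⟩
  · rw [P.mem_support hx'] at hv
    have h1 := P.dist_center x' hx' v hv
    have h2 := P.radius_le x' hx' v hv
    have h3 := P.le_radius x' hx' v hv
    have h4 : dist x x' ≤ 1 / 2 * Metric.infDist x Z := h.1.trans (by gcongr)
    have h5 := Metric.infDist_le_infDist_add_dist (s := Z) (x := x) (y := x')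
    have h6 := Metric.infDist_le_infDist_add_dist (s := Z) (x := x') (y := x)
    rw [dist_comm x' x] at h6
    have h7 := dist_triangle x x' (P.center v)
    have h8 : K * Metric.infDist x' Z ≤ K * (3 / 2 * Metric.infDist x Z) := by
      gcongr; linarith
    refine ⟨by linarith, by linarith, by linarith⟩

theorem Admissible.radius_pos (A : P.Admissible f xhat L M η) {ε : ℝ} (hε : ε ≤ 1 / 2) {x x' : X}
    (hx : x ∉ Z) (hx' : x' ∉ Z) (h : Near Z ε x x') {v : V}
    (hv : v ∈ P.support x ∨ v ∈ P.support x') : 0 < P.radius v := by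
  have h1 := (A.geometry hε hx hx' h hv).2.2
  have h2 := A.infDist_pos hx
  have hK := A.one_le_K
  by_contra hneg
  have : 2 * K * P.radius v ≤ 0 := mul_nonpos_of_nonneg_of_nonpos (by linarith) (not_lt.1 hneg)
  linarith

theorem weight_arg (v : V) (y : Fin n → ℝ) :
    ∑ i, simplexForm (P.color v) i / (L * P.radius v) * y i +
      (η - ∑ i, simplexForm (P.color v) i / (L * P.radius v) * (f (P.center v)).1 i) =
    (∑ i, simplexForm (P.color v) i * (y i - (f (P.center v)).1 i)) / (L * P.radius v) + η := by
  have : (∑ i, simplexForm (P.color v) i * (y i - (f (P.center v)).1 i)) / (L * P.radius v) =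
      ∑ i, simplexForm (P.color v) i / (L * P.radius v) * y i -
        ∑ i, simplexForm (P.color v) i / (L * P.radius v) * (f (P.center v)).1 i := by
    rw [Finset.sum_div, ← Finset.sum_sub_distrib]
    refine Finset.sum_congr rfl fun i _ => ?_
    ring
  rw [this]
  ring

theorem form_basePoint (j : Fin (n + 1)) (ξ : Fin n → ℝ) (x : X) :
    ∑ i, simplexForm j i * (P.basePoint xhat L M x i - ξ i) =
      ∑ i, simplexForm j i * (xhat x - ξ) i +
        M * L * (∑ v ∈ P.support x, P.b v x * (if P.color v = j then (n + 1 : ℝ) else 0) -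
          ∑ v ∈ P.support x, P.b v x) := by
  have e1 : ∀ i, P.basePoint xhat L M x i - ξ i = (xhat x - ξ) i +
      M * L * ∑ v ∈ P.support x, P.b v x * simplexVertex (P.color v) i := by
    intro i
    simp [basePoint, Finset.sum_apply]
    ring
  have e2 : ∑ i, simplexForm j i * (M * L * ∑ v ∈ P.support x,
      P.b v x * simplexVertex (P.color v) i) = M * L * ∑ v ∈ P.support x, P.b v x *
        ∑ i, simplexForm j i * simplexVertex (P.color v) i := by
    simp only [Finset.mul_sum]
    rw [Finset.sum_comm]
    refine Finset.sum_congr rfl fun v _ => Finset.sum_congr rfl fun i _ => ?_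
    ring
  simp only [e1, mul_add, Finset.sum_add_distrib]
  rw [e2]
  simp only [simplexForm_vertex, mul_sub, mul_one, Finset.sum_sub_distrib]

theorem Admissible.abs_form_le (A : P.Admissible f xhat L M η) {ε : ℝ} (hε : ε ≤ 1 / 2) {x x' : X}
    (hx : x ∉ Z) (hx' : x' ∉ Z) (h : Near Z ε x x') {v : V}
    (hv : v ∈ P.support x ∨ v ∈ P.support x') (j : Fin (n + 1)) :
    |∑ i, simplexForm j i * (xhat x - (f (P.center v)).1) i| ≤
      n * (n + 1) * (L * (2 * K * Metric.infDist x Z)) := by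
  refine (abs_simplexForm_sum_le j _).trans ?_
  have h1 := A.xhat_lipschitz x (P.center v)
  rw [A.xhat_eq] at h1
  have h2 := (A.geometry hε hx hx' h hv).1
  have hL := A.L_pos
  gcongr
  exact h1.trans (by gcongr)

theorem Admissible.large_bump (A : P.Admissible f xhat L M η) {x : X} (hx : x ∉ Z) :
    ∃ v ∈ P.support x, c * Metric.infDist x Z ≤ P.b v x := by
  obtain ⟨v, hv⟩ := P.exists_large x hx
  exact ⟨v, (P.mem_support hx).2 ((mul_pos A.c_pos (A.infDist_pos hx)).trans_le hv), hv⟩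

/-- A bump that vanishes at `x`, but not at a near point, has zero weight around the base point
of `x`. -/
theorem Admissible.weight_eventuallyEq_zero (A : P.Admissible f xhat L M η) {ε : ℝ}
    (hε : ε ≤ 1 / 2) (hεc : 8 * (n + 1) * ε ≤ c) {x x' : X}
    (hx : x ∉ Z) (hx' : x' ∉ Z) (h : Near Z ε x x') {w : V}
    (hw : w ∉ P.support x) (hw' : w ∈ P.support x') :
    P.weight f L η w =ᶠ[nhds (P.basePoint xhat L M x)] 0 := by
  refine cutoff_eventuallyEq_zero ?_
  rw [weight_arg, form_basePoint]
  have hd := A.infDist_pos hx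
  have hL := A.L_pos
  have hM := A.M_nonneg
  have hn0 : (0 : ℝ) ≤ n := Nat.cast_nonneg n
  have hr := A.radius_pos hε hx hx' h (Or.inr hw')
  have hη : 0 ≤ η := by
    have := A.η_large
    have : 0 ≤ 4 * K ^ 2 * ((n : ℝ) * (n + 1)) := by positivity
    linarith
  -- At most one bump at `x` has the colour of `w`; it vanishes at `x'`, so it is small at `x`.
  have hsame : ∑ v ∈ P.support x, P.b v x * (if P.color v = P.color w then (n + 1 : ℝ) else 0) ≤
      (n + 1) * (4 * dist x x') := by
    by_cases hex : ∃ v ∈ P.support x, P.color v = P.color w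
    · obtain ⟨v, hv, hvw⟩ := hex
      have hne : v ≠ w := fun e => hw (e ▸ hv)
      have hv0 : P.b v x' = 0 := by
        refine P.b_eq_zero hx' fun hv' => hne ?_
        exact P.eq_of_color_eq x' hx' v w ((P.mem_support hx').1 hv')
          ((P.mem_support hx').1 hw') hvw
      have hsmall : P.b v x ≤ 4 * dist x x' := by
        have := P.lipschitz v x x'
        rw [hv0, sub_zero] at this
        exact (le_abs_self _).trans this
      rw [Finset.sum_eq_single_of_mem v hv]
      · rw [if_pos hvw, mul_comm]
        gcongr
      · intro u hu huv
        rw [if_neg, mul_zero]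
        intro huw
        exact huv (P.eq_of_color_eq x hx u v ((P.mem_support hx).1 hu)
          ((P.mem_support hx).1 hv) (huw.trans hvw.symm))
    · rw [Finset.sum_eq_zero]
      · positivity
      · intro v hv
        rw [if_neg fun e => hex ⟨v, hv, e⟩, mul_zero]
  obtain ⟨v₁, hv₁, hlarge⟩ := A.large_bump hx
  have hsum : c * Metric.infDist x Z ≤ ∑ v ∈ P.support x, P.b v x :=
    hlarge.trans (Finset.single_le_sum (f := fun v => P.b v x) (fun v _ => P.nonneg v x) hv₁)
  have habs := (abs_le.1 (A.abs_form_le hε hx hx' h (Or.inr hw') (P.color w))).2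
  have hrd := (A.geometry hε hx hx' h (Or.inr hw')).2.1
  rw [← lt_neg_iff_add_neg, div_lt_iff₀ (by positivity)]
  have hdiff : ∑ v ∈ P.support x, P.b v x * (if P.color v = P.color w then (n + 1 : ℝ) else 0) -
      ∑ v ∈ P.support x, P.b v x ≤ -(c / 2 * Metric.infDist x Z) := by
    have h1 : (n + 1) * (4 * dist x x') ≤ (n + 1) * (4 * (ε * Metric.infDist x Z)) := by
      gcongr
      exact h.1
    have h2 : 8 * (n + 1) * ε * Metric.infDist x Z ≤ c * Metric.infDist x Z := by gcongr
    linarith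
  have h3 := mul_le_mul_of_nonneg_left hdiff (mul_nonneg hM hL.le)
  have h4 : η * (L * P.radius w) ≤ η * (L * (2 * K * Metric.infDist x Z)) := by gcongr
  have h5 := mul_lt_mul_of_pos_right A.M_large (mul_pos hL hd)
  linarith

/-- Some bump at `x` has weight one around the base point of `x`. -/
theorem Admissible.exists_weight_eventuallyEq_one (A : P.Admissible f xhat L M η) {x : X}
    (hx : x ∉ Z) :
    ∃ v ∈ P.support x, P.weight f L η v =ᶠ[nhds (P.basePoint xhat L M x)] 1 := by
  have hd := A.infDist_pos hx
  have hL := A.L_pos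
  have hM := A.M_nonneg
  have hK := A.one_le_K
  have hn0 : (0 : ℝ) ≤ n := Nat.cast_nonneg n
  have hnear : Near Z 0 x x := by simp [Near]
  obtain ⟨v₁, hv₁, -⟩ := A.large_bump hx
  obtain ⟨v, hv, hmax⟩ := Finset.exists_max_image (P.support x) (fun v => P.b v x) ⟨v₁, hv₁⟩
  refine ⟨v, hv, cutoff_eventuallyEq_one ?_⟩
  rw [weight_arg, form_basePoint]
  have hr := A.radius_pos (by norm_num) hx hx hnear (Or.inl hv)
  have hsame : (n + 1) * P.b v x ≤
      ∑ u ∈ P.support x, P.b u x * (if P.color u = P.color v then (n + 1 : ℝ) else 0) := by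
    have := Finset.single_le_sum
      (f := fun u => P.b u x * (if P.color u = P.color v then (n + 1 : ℝ) else 0))
      (fun u _ => mul_nonneg (P.nonneg u x) (by split_ifs <;> positivity)) hv
    simp only [if_true] at this
    linarith
  have hsum : ∑ u ∈ P.support x, P.b u x ≤ (n + 1) * P.b v x := by
    refine (Finset.sum_le_card_nsmul _ _ _ hmax).trans ?_
    rw [nsmul_eq_mul]
    have : ((P.support x).card : ℝ) ≤ n + 1 := by exact_mod_cast P.card_support_le hx
    exact mul_le_mul_of_nonneg_right this (P.nonneg v x)
  have habs := (abs_le.1 (A.abs_form_le (by norm_num) hx hx hnear (Or.inl hv) (P.color v))).1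
  have hrd := (A.geometry (by norm_num) hx hx hnear (Or.inl hv)).2.2
  rw [← sub_lt_iff_lt_add, lt_div_iff₀ (by positivity)]
  have h3 := mul_le_mul_of_nonneg_left (hsum.trans hsame) (mul_nonneg hM hL.le)
  have h4 : n * (n + 1) * (L * (2 * K * Metric.infDist x Z)) ≤
      n * (n + 1) * (L * (2 * K * (2 * K * P.radius v))) := by gcongr
  have h5 := mul_lt_mul_of_pos_right A.η_large (mul_pos hL hr)
  linarith

theorem Admissible.norm_basePoint_sub_xhat_le (A : P.Admissible f xhat L M η) {x : X}
    (hx : x ∉ Z) :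
    ‖P.basePoint xhat L M x - xhat x‖ ≤ M * (n + 1) * (L * Metric.infDist x Z) := by
  have hL := A.L_pos
  have hM := A.M_nonneg
  rw [basePoint, add_sub_cancel_left, norm_smul, Real.norm_of_nonneg (by positivity)]
  have h1 : ‖∑ v ∈ P.support x, P.b v x • (simplexVertex (P.color v) : Fin n → ℝ)‖ ≤
      (n + 1) * Metric.infDist x Z := by
    refine (norm_sum_le _ _).trans ((Finset.sum_le_card_nsmul _ _ (Metric.infDist x Z)
      fun v _ => ?_).trans ?_)
    · rw [norm_smul, Real.norm_of_nonneg (P.nonneg v x)]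
      have := mul_le_mul (P.le_infDist v x) (norm_simplexVertex_le (P.color v)) (norm_nonneg _)
        Metric.infDist_nonneg
      linarith
    · rw [nsmul_eq_mul]
      have : ((P.support x).card : ℝ) ≤ n + 1 := by exact_mod_cast P.card_support_le hx
      exact mul_le_mul_of_nonneg_right this Metric.infDist_nonneg
  calc M * L * _ ≤ M * L * ((n + 1) * Metric.infDist x Z) := by gcongr
    _ = _ := by ring

theorem Admissible.norm_basePoint_sub_le (A : P.Admissible f xhat L M η) {x x' : X}
    (hx : x ∉ Z) (hx' : x' ∉ Z) :
    ‖P.basePoint xhat L M x' - P.basePoint xhat L M x‖ ≤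
      (1 + 8 * (n + 1) * M) * (L * dist x x') := by
  classical
  have hL := A.L_pos
  have hM := A.M_nonneg
  set S := P.support x ∪ P.support x' with hS
  have e1 : ∑ v ∈ P.support x, P.b v x • (simplexVertex (P.color v) : Fin n → ℝ) =
      ∑ v ∈ S, P.b v x • simplexVertex (P.color v) :=
    Finset.sum_subset Finset.subset_union_left fun v _ hv => by rw [P.b_eq_zero hx hv, zero_smul]
  have e2 : ∑ v ∈ P.support x', P.b v x' • (simplexVertex (P.color v) : Fin n → ℝ) =
      ∑ v ∈ S, P.b v x' • simplexVertex (P.color v) :=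
    Finset.sum_subset Finset.subset_union_right fun v _ hv => by rw [P.b_eq_zero hx' hv, zero_smul]
  have e3 : P.basePoint xhat L M x' - P.basePoint xhat L M x = (xhat x' - xhat x) +
      (M * L) • ∑ v ∈ S, (P.b v x' - P.b v x) • (simplexVertex (P.color v) : Fin n → ℝ) := by
    simp only [basePoint, e1, e2, sub_smul, Finset.sum_sub_distrib, smul_sub]
    abel
  have hcard : (S.card : ℝ) ≤ 2 * (n + 1) := by
    have h1 : S.card ≤ (P.support x).card + (P.support x').card := Finset.card_union_le _ _
    have h2 := P.card_support_le hx
    have h3 := P.card_support_le hx'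
    have h4 : S.card ≤ 2 * (n + 1) := by omega
    exact_mod_cast h4
  have h1 : ‖∑ v ∈ S, (P.b v x' - P.b v x) • (simplexVertex (P.color v) : Fin n → ℝ)‖ ≤
      2 * (n + 1) * (4 * dist x x') := by
    refine (norm_sum_le _ _).trans ((Finset.sum_le_card_nsmul _ _ (4 * dist x x')
      fun v _ => ?_).trans ?_)
    · rw [norm_smul, Real.norm_eq_abs]
      have h1 := P.lipschitz v x' x
      rw [dist_comm] at h1
      have := mul_le_mul h1 (norm_simplexVertex_le (P.color v)) (norm_nonneg _) (by positivity)
      linarith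
    · rw [nsmul_eq_mul]
      gcongr
  rw [e3]
  refine (norm_add_le _ _).trans ?_
  rw [norm_smul, Real.norm_of_nonneg (mul_nonneg hM hL.le)]
  have h2 := A.xhat_lipschitz x' x
  rw [dist_comm] at h2
  calc _ ≤ L * dist x x' + M * L * (2 * (n + 1) * (4 * dist x x')) := by gcongr
    _ = _ := by ring

/-- A relative radius of a ball in `ℝⁿ` that contains the base points under consideration. -/
def ballRadius (n : ℕ) (K M : ℝ) : ℝ := 2 * K + M * (n + 1) + (1 + 8 * (n + 1) * M)

/-- The bound, at unit scale, for the derivatives of the blended functions relative to a Taylor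
polynomial of one of the nearby jets; `C₀` bounds the derivatives of the smooth step. -/
def blendConst (n k : ℕ) (K M C₀ : ℝ) : ℝ :=
  ((1 + 2 ^ (k + 1) * ((2 * K * (n + 1)) ^ (k + 1) * C₀)) ^ (2 * (n + 1)) - 1) *
    ((1 + n * ballRadius n K M) ^ (k + 1) * (n * (4 * K + 1)) ^ (k + 1))

theorem sort_filter_mem [LinearOrder V] {S T : Finset V} (h : T ⊆ S) :
    S.sort.filter (fun v => decide (v ∈ T)) = T.sort := by
  refine List.Perm.eq_of_pairwise (le := (· ≤ ·)) (fun a b _ _ => le_antisymm)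
    ((Finset.pairwise_sort S (· ≤ ·)).filter _) (Finset.pairwise_sort T (· ≤ ·)) ?_
  rw [List.perm_ext_iff_of_nodup ((Finset.sort_nodup S (· ≤ ·)).filter _)
    (Finset.sort_nodup T (· ≤ ·))]
  intro v
  simp only [List.mem_filter, Finset.mem_sort, decide_eq_true_eq]
  exact ⟨fun hv => hv.2, fun hv => ⟨h hv, hv⟩⟩

theorem Admissible.jet_germ_eq [LinearOrder V] (A : P.Admissible f xhat L M η) {ε : ℝ}
    (hε : ε ≤ 1 / 2) (hεc : 8 * (n + 1) * ε ≤ c) {x x' : X}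
    (hx : x ∉ Z) (hx' : x' ∉ Z) (h : Near Z ε x x') {S : Finset V}
    (hS : ∀ v, v ∈ S ↔ v ∈ P.support x ∨ v ∈ P.support x') (R : (Fin n → ℝ) → ℝ) :
    jet k (blend (P.weight f L η) (fun v => taylor (f (P.center v))) R S.sort)
      (P.basePoint xhat L M x) = jet k (P.germ f L η x) (P.basePoint xhat L M x) := by
  refine jet_congr ?_
  have hsub : P.support x ⊆ S := fun v hv => (hS v).2 (Or.inl hv)
  refine (blend_eventuallyEq_filter (fun v => decide (v ∈ P.support x)) S.sort ?_).trans ?_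
  · intro v hv hvx
    have hv1 : v ∉ P.support x := by simpa using hvx
    have hv2 : v ∈ P.support x' := ((hS v).1 ((Finset.mem_sort _).1 hv)).resolve_left hv1
    exact A.weight_eventuallyEq_zero hε hεc hx hx' h hv1 hv2
  · rw [sort_filter_mem hsub]
    obtain ⟨v, hv, h1⟩ := A.exists_weight_eventuallyEq_one hx
    exact blend_eventuallyEq_of_weight_eq_one _ ⟨v, (Finset.mem_sort _).2 hv, h1⟩

/-- At two near points the extension is given by the jets of one and the same function, which is
close to the Taylor polynomial of one of the given jets. -/
theorem Admissible.exists_common_function [LinearOrder V] (A : P.Admissible f xhat L M η) {ε : ℝ}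
    (hε : ε ≤ 1 / 2) (hεc : 8 * (n + 1) * ε ≤ c) {C₀ : ℝ} (hC₀ : 1 ≤ C₀)
    (hcut : ∀ (a : Fin n → ℝ) (b ρ D : ℝ), 0 ≤ ρ → 1 ≤ D → (∀ i, |a i| * ρ ≤ D) →
      DerivBound (k + 1) ρ Set.univ (D ^ (k + 1) * C₀) (cutoff a b)) {x x' : X}
    (hx : x ∉ Z) (hx' : x' ∉ Z) (h : Near Z ε x x') :
    ∃ v ∈ P.support x, ∃ G : (Fin n → ℝ) → ℝ, Smooth G ∧
      jet k G (P.basePoint xhat L M x) = jet k (P.germ f L η x) (P.basePoint xhat L M x) ∧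
      jet k G (P.basePoint xhat L M x') = jet k (P.germ f L η x') (P.basePoint xhat L M x') ∧
      DerivBound (k + 1) (L * Metric.infDist x Z)
        (Metric.closedBall (f (P.center v)).1 (ballRadius n K M * (L * Metric.infDist x Z)))
        (blendConst n k K M C₀ * (L * Metric.infDist x Z) ^ (k + 1))
        (G - taylor (f (P.center v))) ∧
      P.basePoint xhat L M x ∈
        Metric.closedBall (f (P.center v)).1 (ballRadius n K M * (L * Metric.infDist x Z)) ∧
      P.basePoint xhat L M x' ∈
        Metric.closedBall (f (P.center v)).1 (ballRadius n K M * (L * Metric.infDist x Z)) := by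
  classical
  have hd := A.infDist_pos hx
  have hL := A.L_pos
  have hM := A.M_nonneg
  have hK := A.one_le_K
  have hn1 : (1 : ℝ) ≤ n := by exact_mod_cast A.one_le_n
  set ρ : ℝ := L * Metric.infDist x Z with hρ
  have hρ0 : 0 < ρ := mul_pos hL hd
  have hR : 0 ≤ ballRadius n K M := by unfold ballRadius; positivity
  obtain ⟨v, hv, -⟩ := A.large_bump hx
  set S := P.support x ∪ P.support x' with hSdef
  have hS : ∀ v, v ∈ S ↔ v ∈ P.support x ∨ v ∈ P.support x' := fun v => Finset.mem_union
  set R := taylor (f (P.center v)) with hRdef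
  have sT : ∀ v, Smooth (taylor (f (P.center v))) := fun v => smooth_taylor _
  refine ⟨v, hv, blend (P.weight f L η) (fun v => taylor (f (P.center v))) R S.sort,
    smooth_blend (P.smooth_weight f L η) sT (sT v) _, A.jet_germ_eq hε hεc hx hx' h hS R,
    A.jet_germ_eq hε hεc hx' hx h.symm (fun v => (hS v).trans or_comm) R, ?_, ?_⟩
  · have bΨ : ∀ w ∈ S.sort, DerivBound (k + 1) ρ
        (Metric.closedBall (f (P.center v)).1 (ballRadius n K M * ρ))
        ((2 * K * (n + 1)) ^ (k + 1) * C₀) (P.weight f L η w) := by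
      intro w hw l hl y _
      have hwS := (hS w).1 ((Finset.mem_sort _).1 hw)
      have hr := A.radius_pos hε hx hx' h hwS
      refine hcut _ _ ρ (2 * K * (n + 1)) hρ0.le (by nlinarith) (fun i => ?_) l hl y (Set.mem_univ y)
      rw [abs_div, abs_of_pos (mul_pos hL hr), hρ, div_mul_eq_mul_div, div_le_iff₀ (mul_pos hL hr)]
      have h1 := (A.geometry hε hx hx' h hwS).2.2
      calc |simplexForm (P.color w) i| * (L * Metric.infDist x Z)
          ≤ (n + 1) * (L * (2 * K * P.radius w)) := by
            gcongr
            exact abs_simplexForm_le _ _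
        _ = _ := by ring
    have bT : ∀ w ∈ S.sort, DerivBound (k + 1) ρ
        (Metric.closedBall (f (P.center v)).1 (ballRadius n K M * ρ))
        ((1 + n * ballRadius n K M) ^ (k + 1) * ((n * (4 * K + 1)) ^ (k + 1) * ρ ^ (k + 1)))
        (taylor (f (P.center w)) - R) := by
      intro w hw
      have hwS := (hS w).1 ((Finset.mem_sort _).1 hw)
      refine derivBound_taylor_sub A.one_le_n (by linarith) hρ0 hR ?_
      refine (A.lipschitz _ _).trans_lt ((ENNReal.ofReal_lt_ofReal_iff (by positivity)).2 ?_)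
      have h1 := (A.geometry hε hx hx' h hwS).1
      have h2 := (A.geometry hε hx hx' h (Or.inl hv)).1
      have h3 := dist_triangle_left (P.center w : X) (P.center v) x
      have h4 : dist (P.center w) (P.center v) ≤ 4 * K * Metric.infDist x Z := by
        rw [Subtype.dist_eq]; linarith
      calc L * dist (P.center w) (P.center v) ≤ L * (4 * K * Metric.infDist x Z) := by gcongr
        _ < (4 * K + 1) * ρ := by rw [hρ]; nlinarith [mul_pos hL hd]
    have hlen : S.sort.length ≤ 2 * (n + 1) := by
      rw [Finset.length_sort]
      have h1 : S.card ≤ (P.support x).card + (P.support x').card := Finset.card_union_le _ _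
      have h2 := P.card_support_le hx
      have h3 := P.card_support_le hx'
      omega
    refine (derivBound_blend_sub hρ0.le (P.smooth_weight f L η) sT (sT v) S.sort bΨ bT).mono ?_
    rw [blendConst, ← mul_assoc ((1 + n * ballRadius n K M) ^ (k + 1)), ← mul_assoc]
    have hQ : 1 ≤ 1 + 2 ^ (k + 1) * ((2 * K * (n + 1)) ^ (k + 1) * C₀) := by
      have : 0 ≤ 2 ^ (k + 1) * ((2 * K * (n + 1)) ^ (k + 1) * C₀) := by positivity
      linarith
    gcongr
  · have h1 : dist (P.basePoint xhat L M x) (f (P.center v)).1 ≤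
        (2 * K + M * (n + 1)) * ρ := by
      have e1 := A.norm_basePoint_sub_xhat_le hx
      have e2 := A.xhat_lipschitz x (P.center v)
      rw [A.xhat_eq] at e2
      have e3 : L * dist x (P.center v) ≤ L * (2 * K * Metric.infDist x Z) :=
        mul_le_mul_of_nonneg_left (A.geometry hε hx hx' h (Or.inl hv)).1 hL.le
      have e4 := dist_triangle (P.basePoint xhat L M x) (xhat x) (f (P.center v)).1
      rw [dist_eq_norm (P.basePoint xhat L M x) (xhat x), dist_eq_norm (xhat x)] at e4
      rw [hρ]
      linarith
    have h2 : dist (P.basePoint xhat L M x') (P.basePoint xhat L M x) ≤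
        (1 + 8 * (n + 1) * M) * ρ := by
      rw [dist_eq_norm]
      refine (A.norm_basePoint_sub_le hx hx').trans ?_
      rw [hρ]
      gcongr
      refine h.1.trans ?_
      calc ε * Metric.infDist x Z ≤ 1 * Metric.infDist x Z := by gcongr; linarith
        _ = _ := one_mul _
    have h3 := dist_triangle (P.basePoint xhat L M x') (P.basePoint xhat L M x)
      (f (P.center v)).1
    have h4 : 0 ≤ (1 + 8 * (n + 1) * M) * ρ := by positivity
    simp only [Metric.mem_closedBall, ballRadius]
    constructor <;> linarith

theorem blendConst_nonneg (hK : 1 ≤ K) (hM : 0 ≤ M) {C₀ : ℝ} (hC₀ : 1 ≤ C₀) :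
    0 ≤ blendConst n k K M C₀ := by
  have hR : 0 ≤ ballRadius n K M := by unfold ballRadius; positivity
  have hQ : 1 ≤ 1 + 2 ^ (k + 1) * ((2 * K * (n + 1)) ^ (k + 1) * C₀) := by
    have : 0 ≤ 2 ^ (k + 1) * ((2 * K * (n + 1)) ^ (k + 1) * C₀) := by positivity
    linarith
  have := one_le_pow₀ hQ (n := 2 * (n + 1))
  exact mul_nonneg (by linarith) (by positivity)

theorem Admissible.ccDist_jet_germ_le [LinearOrder V] (A : P.Admissible f xhat L M η) {ε : ℝ}
    (hε : ε ≤ 1 / 2) (hεc : 8 * (n + 1) * ε ≤ c) {C₀ : ℝ} (hC₀ : 1 ≤ C₀)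
    (hcut : ∀ (a : Fin n → ℝ) (b ρ D : ℝ), 0 ≤ ρ → 1 ≤ D → (∀ i, |a i| * ρ ≤ D) →
      DerivBound (k + 1) ρ Set.univ (D ^ (k + 1) * C₀) (cutoff a b)) {x x' : X}
    (hx : x ∉ Z) (hx' : x' ∉ Z) (h : Near Z ε x x') :
    ccDist (jet k (P.germ f L η x) (P.basePoint xhat L M x))
      (jet k (P.germ f L η x') (P.basePoint xhat L M x')) ≤
      ENNReal.ofReal ((n + Fintype.card (MultiIdx n k) * (n * blendConst n k K M C₀)) *
        (1 + 8 * (n + 1) * M) * (L * dist x x')) := by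
  obtain ⟨v, -, G, hG, e, e', hb, hm, hm'⟩ := A.exists_common_function hε hεc hC₀ hcut hx hx' h
  have hρ : 0 < L * Metric.infDist x Z := mul_pos A.L_pos (A.infDist_pos hx)
  have hB := blendConst_nonneg (n := n) (k := k) A.one_le_K A.M_nonneg hC₀
  rw [← e, ← e']
  have := ccDist_jet_le (k := k) hG (convex_closedBall _ _) (M := blendConst n k K M C₀)
    (fun l hl y hy => by
      have h1 := hb l hl.le y hy
      rw [listDeriv_sub hG (smooth_taylor _), listDeriv_taylor_eq_zero _ (by omega), sub_zero,
        hl] at h1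
      exact le_of_mul_le_mul_right h1 (by positivity)) hm hm'
  refine this.trans (ENNReal.ofReal_le_ofReal ?_)
  rw [mul_assoc]
  gcongr
  exact A.norm_basePoint_sub_le hx hx'

theorem Admissible.ccDist_center_le [LinearOrder V] (A : P.Admissible f xhat L M η) {ε : ℝ}
    (hε0 : 0 ≤ ε) (hε : ε ≤ 1 / 2) (hεc : 8 * (n + 1) * ε ≤ c) {C₀ : ℝ} (hC₀ : 1 ≤ C₀)
    (hcut : ∀ (a : Fin n → ℝ) (b ρ D : ℝ), 0 ≤ ρ → 1 ≤ D → (∀ i, |a i| * ρ ≤ D) →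
      DerivBound (k + 1) ρ Set.univ (D ^ (k + 1) * C₀) (cutoff a b)) {C₁ : ℝ}
    (hC₁ : ∀ (p q : JetSpace n k) (ρ : ℝ), 0 < ρ → ‖q.1 - p.1‖ ≤ ballRadius n K M * ρ →
      (∀ J : MultiIdx n k, |q.2 J - multiDeriv J.1 (taylor p) q.1| * ρ ^ J.deg ≤
        blendConst n k K M C₀ * ρ ^ (k + 1)) →
      ccDist p q ≤ ENNReal.ofReal (C₁ * ρ)) {x : X} (hx : x ∉ Z) :
    ∃ z : Z, dist x z ≤ K * Metric.infDist x Z ∧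
      ccDist (f z) (jet k (P.germ f L η x) (P.basePoint xhat L M x)) ≤
        ENNReal.ofReal (C₁ * (L * Metric.infDist x Z)) := by
  have hnear : Near Z ε x x := by
    have : 0 ≤ ε * Metric.infDist x Z := mul_nonneg hε0 Metric.infDist_nonneg
    simp [Near, this]
  obtain ⟨v, hv, G, hG, e, -, hb, hm, -⟩ := A.exists_common_function hε hεc hC₀ hcut hx hx hnear
  refine ⟨P.center v, P.dist_center x hx v ((P.mem_support hx).1 hv), ?_⟩
  rw [← e]
  refine hC₁ _ _ _ (mul_pos A.L_pos (A.infDist_pos hx)) ?_ fun J => ?_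
  · rwa [Metric.mem_closedBall, dist_eq_norm] at hm
  · have hlen : (dirList J.1).length = J.deg := length_dirList _
    have h1 := hb (dirList J.1) (by rw [hlen]; exact J.sum_le.trans (Nat.le_succ k)) _ hm
    rw [listDeriv_sub hG (smooth_taylor _), hlen] at h1
    exact h1

/-- Jets over a space with coloured bump functions can be extended with a Lipschitz constant that
depends only on the parameters of the bump functions. -/
theorem exists_lipschitz_extension (n k : ℕ) (hn : 1 ≤ n) {c K : ℝ} (hc : 0 < c) (hK : 1 ≤ K) :
    ∃ C : ℝ, 0 ≤ C ∧ ∀ (X : Type*) [MetricSpace X] (Z : Set X), Z.Nonempty → IsClosed Z →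
      ∀ (V : Type*), ColoredBumps Z n c K V →
        ∀ (L : ℝ≥0) (f : Z → JetSpace n k), 0 < L → LipschitzToJet L f →
          ∃ F : X → JetSpace n k, (∀ z : Z, F z = f z) ∧
            ∀ x x', ccDist (F x) (F x') ≤ ENNReal.ofReal (C * (L * dist x x')) := by
  obtain ⟨C₀, hC₀, hcut⟩ := derivBound_cutoff (n := n) (k + 1)
  set η : ℝ := 4 * K ^ 2 * (n * (n + 1)) + 2 with hη
  set M : ℝ := (4 * K * (n * (n + 1) + η) + 1) / c with hM
  have hM0 : 0 ≤ M := by positivity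
  set ε : ℝ := min (1 / 2) (c / (8 * (n + 1))) with hε
  have hε0 : 0 < ε := lt_min (by norm_num) (by positivity)
  have hε2 : ε ≤ 1 / 2 := min_le_left _ _
  have hεc : 8 * (n + 1) * ε ≤ c := by
    have : ε ≤ c / (8 * (n + 1)) := min_le_right _ _
    rw [le_div_iff₀ (by positivity)] at this
    linarith
  have hB := blendConst_nonneg (n := n) (k := k) hK hM0 hC₀
  obtain ⟨C₁, hC₁0, hC₁⟩ := ccDist_le_of_taylor_close (k := k) hn (ballRadius n K M)
    (blendConst n k K M C₀) (by unfold ballRadius; positivity) hB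
  set C₂ : ℝ := (n + Fintype.card (MultiIdx n k) * (n * blendConst n k K M C₀)) *
    (1 + 8 * (n + 1) * M) with hC₂
  have hC₂0 : 0 ≤ C₂ := by positivity
  set C₃ : ℝ := 2 * (C₁ + K) * (1 / ε + 1) + 1 with hC₃
  have hC₃0 : 0 ≤ C₃ := by positivity
  refine ⟨C₂ + C₃ + (C₁ + K + 1), by positivity, ?_⟩
  intro X _ Z hZ hZc V P L f hL hf
  obtain ⟨xhat₀, hxl, hxe⟩ := LipschitzOnWith.extend_pi (K := L) (s := Z)
    (f := fun x => open Classical in if h : x ∈ Z then (f ⟨x, h⟩).1 else 0) (by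
      intro x hx y hy
      simp only [dif_pos hx, dif_pos hy]
      exact (edist_fst_le_ccDist _ _).trans (hf ⟨x, hx⟩ ⟨y, hy⟩))
  let : LinearOrder V := IsWellOrder.linearOrder WellOrderingRel
  have A : P.Admissible f xhat₀ L M η :=
    { isClosed := hZc
      nonempty := hZ
      one_le_n := hn
      c_pos := hc
      one_le_K := hK
      L_pos := hL
      M_nonneg := hM0
      η_large := by rw [hη]; linarith
      M_large := by rw [hM, div_mul_cancel₀ _ hc.ne']; linarith
      lipschitz := fun z z' => by
        refine (hf z z').trans (le_of_eq ?_)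
        rw [edist_dist, ENNReal.ofReal_mul L.coe_nonneg, ENNReal.ofReal_coe_nnreal]
      xhat_lipschitz := fun x x' => by
        rw [← dist_eq_norm]
        exact hxl.dist_le_mul x x'
      xhat_eq := fun z => by
        have := hxe z.2
        simp only [dif_pos z.2] at this
        exact this.symm }
  classical
  set F : X → JetSpace n k := fun x => if h : x ∈ Z then f ⟨x, h⟩ else
    jet k (P.germ f L η x) (P.basePoint xhat₀ L M x) with hF
  have hL' : (0 : ℝ) < L := hL
  have FZ : ∀ z : Z, F z = f z := fun z => by simp [hF]
  have trans : ∀ {p q r : JetSpace n k} {a b : ℝ}, 0 ≤ a → 0 ≤ b → ccDist p q ≤ ENNReal.ofReal a →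
      ccDist q r ≤ ENNReal.ofReal b → ccDist p r ≤ ENNReal.ofReal (a + b) := by
    intro p q r a b ha hb h1 h2
    rw [ENNReal.ofReal_add ha hb]
    exact (ccDist_triangle p q r).trans (add_le_add h1 h2)
  have center : ∀ x ∉ Z, ∃ z : Z, dist x z ≤ K * Metric.infDist x Z ∧
      ccDist (f z) (F x) ≤ ENNReal.ofReal (C₁ * (L * Metric.infDist x Z)) := by
    intro x hx
    simp only [hF, dif_neg hx]
    exact A.ccDist_center_le hε0.le hε2 hεc hC₀ hcut hC₁ hx
  have mixed : ∀ (z : Z) (x : X), x ∉ Z →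
      ccDist (f z) (F x) ≤ ENNReal.ofReal ((C₂ + C₃ + (C₁ + K + 1)) * (L * dist (z : X) x)) := by
    intro z x hx
    obtain ⟨w, hw, hwF⟩ := center x hx
    refine (trans (by positivity) (mul_nonneg hC₁0 (mul_nonneg hL'.le Metric.infDist_nonneg))
      (A.lipschitz z w) hwF).trans (ENNReal.ofReal_le_ofReal ?_)
    have h1 : Metric.infDist x Z ≤ dist (z : X) x := by
      rw [dist_comm]; exact Metric.infDist_le_dist_of_mem z.2
    have h2 : dist z w ≤ (1 + K) * dist (z : X) x := by
      rw [Subtype.dist_eq]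
      have := dist_triangle (z : X) x w
      have : K * Metric.infDist x Z ≤ K * dist (z : X) x := by gcongr
      linarith
    calc L * dist z w + C₁ * (L * Metric.infDist x Z)
        ≤ L * ((1 + K) * dist (z : X) x) + C₁ * (L * dist (z : X) x) := by gcongr
      _ = (0 + (C₁ + K + 1)) * (L * dist (z : X) x) := by ring
      _ ≤ _ := by gcongr; positivity
  refine ⟨F, FZ, fun x x' => ?_⟩
  have hone : (1 : ℝ) ≤ C₂ + C₃ + (C₁ + K + 1) := by linarith
  by_cases hx : x ∈ Z <;> by_cases hx' : x' ∈ Z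
  · rw [FZ ⟨x, hx⟩, FZ ⟨x', hx'⟩]
    refine (A.lipschitz ⟨x, hx⟩ ⟨x', hx'⟩).trans (ENNReal.ofReal_le_ofReal ?_)
    exact le_mul_of_one_le_left (mul_nonneg hL'.le dist_nonneg) hone
  · rw [FZ ⟨x, hx⟩]
    exact mixed ⟨x, hx⟩ x' hx'
  · rw [FZ ⟨x', hx'⟩, ccDist_comm, dist_comm]
    exact mixed ⟨x', hx'⟩ x hx
  · by_cases hnear : Near Z ε x x'
    · have := A.ccDist_jet_germ_le hε2 hεc hC₀ hcut hx hx' hnear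
      simp only [hF, dif_neg hx, dif_neg hx']
      refine this.trans (ENNReal.ofReal_le_ofReal ?_)
      have h0 : 0 ≤ L * dist x x' := by positivity
      refine mul_le_mul_of_nonneg_right ?_ h0
      rw [← hC₂]
      linarith
    · -- For far points the distances to `Z` are controlled by the mutual distance.
      have hd := Metric.infDist_le_infDist_add_dist (s := Z) (x := x) (y := x')
      have hd' := Metric.infDist_le_infDist_add_dist (s := Z) (x := x') (y := x)
      rw [dist_comm x' x] at hd'
      have h0 := dist_nonneg (x := x) (y := x')
      have hboth : Metric.infDist x Z ≤ (1 / ε + 1) * dist x x' ∧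
          Metric.infDist x' Z ≤ (1 / ε + 1) * dist x x' := by
        rw [Near, not_and_or, not_le, not_le] at hnear
        rcases hnear with h | h
        · have h1 : Metric.infDist x Z ≤ 1 / ε * dist x x' := by
            rw [div_mul_eq_mul_div, one_mul, le_div_iff₀ hε0]
            linarith
          constructor <;> linarith
        · have h1 : Metric.infDist x' Z ≤ 1 / ε * dist x x' := by
            rw [div_mul_eq_mul_div, one_mul, le_div_iff₀ hε0]
            linarith
          constructor <;> linarith
      obtain ⟨z, hz, hzF⟩ := center x hx
      obtain ⟨z', hz', hzF'⟩ := center x' hx'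
      have p0 := Metric.infDist_nonneg (x := x) (s := Z)
      have p0' := Metric.infDist_nonneg (x := x') (s := Z)
      rw [ccDist_comm] at hzF
      refine (trans (by positivity) (by positivity) hzF
        (trans (by positivity) (by positivity) (A.lipschitz z z') hzF')).trans
        (ENNReal.ofReal_le_ofReal ?_)
      have h2 : dist z z' ≤ K * Metric.infDist x Z + dist x x' + K * Metric.infDist x' Z := by
        rw [Subtype.dist_eq]
        have := dist_triangle4 (z : X) x x' z'
        rw [dist_comm (z : X) x] at this
        linarith
      calc C₁ * (L * Metric.infDist x Z) + (L * dist z z' + C₁ * (L * Metric.infDist x' Z))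
          ≤ C₁ * (L * Metric.infDist x Z) + (L * (K * Metric.infDist x Z + dist x x' +
              K * Metric.infDist x' Z) + C₁ * (L * Metric.infDist x' Z)) := by gcongr
        _ ≤ C₁ * (L * ((1 / ε + 1) * dist x x')) + (L * (K * ((1 / ε + 1) * dist x x') +
              dist x x' + K * ((1 / ε + 1) * dist x x')) +
              C₁ * (L * ((1 / ε + 1) * dist x x'))) := by
            gcongr
            · exact hboth.1
            · exact hboth.1
            · exact hboth.2
            · exact hboth.2
        _ = C₃ * (L * dist x x') := by rw [hC₃]; ring
        _ ≤ _ := by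
            have h3 : 0 ≤ L * dist x x' := by positivity
            refine mul_le_mul_of_nonneg_right ?_ h3
            linarith

end

end ColoredBumps

end

theorem theorem4p1 (n k : ℕ) (hn : 1 ≤ n) (hk : 1 ≤ k) (α β : ℝ) (hα : 0 < α) (hβ : 0 < β) :
    ∃ C : ℝ≥0, ∀ (X : Type*) [MetricSpace X] (Z : Set X), Z.Nonempty → IsClosed Z →
      ∀ (ι : Type*) (B : ι → Set X),
        (∀ i, B i ⊆ Zᶜ) →
        Zᶜ ⊆ ⋃ i, B i →
        (∀ i, Metric.ediam (B i) ≤ ENNReal.ofReal α * setDist (B i) Z) →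
        (∀ D : Set X, D ⊆ Zᶜ → Metric.ediam D ≤ ENNReal.ofReal β * setDist D Z →
          {i | (D ∩ B i).Nonempty}.encard ≤ n + 1) →
        ∀ (L : ℝ≥0) (f : Z → JetSpace n k), LipschitzToJet L f →
          ∃ F : X → JetSpace n k, (∀ z : Z, F z = f z) ∧ LipschitzToJet (C * L) F := by
  obtain ⟨c, K, hc, hK, hbumps⟩ := exists_coloredBumps n hα hβ
  obtain ⟨C, hC, hext⟩ := ColoredBumps.exists_lipschitz_extension n k hn hc hK
  refine ⟨C.toNNReal, fun X _ Z hZ hZc ι B hB hcov hdiam hmult L f hf => ?_⟩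
  obtain ⟨P⟩ := hbumps X Z hZ hZc ι B hB hcov hdiam hmult
  rcases eq_or_ne L 0 with rfl | hL
  · -- A `0`-Lipschitz map is extended by one of its values.
    classical
    obtain ⟨z₀, hz₀⟩ := hZ
    refine ⟨fun x => if h : x ∈ Z then f ⟨x, h⟩ else f ⟨z₀, hz₀⟩, fun z => by simp, ?_⟩
    have h0 : ∀ z z' : Z, JetSpace.ccDist (f z) (f z') ≤ 0 := fun z z' => by
      simpa using hf z z'
    intro x x'
    refine le_trans ?_ (zero_le (a := _))
    dsimp only
    split_ifs <;> exact h0 _ _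
  · obtain ⟨F, hF, hFL⟩ := hext X Z hZ hZc _ P L f (pos_iff_ne_zero.2 hL) hf
    refine ⟨F, hF, fun x x' => (hFL x x').trans (le_of_eq ?_)⟩
    rw [edist_dist, ENNReal.ofReal_mul hC, ENNReal.ofReal_mul L.coe_nonneg, ENNReal.ofReal_coe_nnreal,
      ENNReal.coe_mul, mul_assoc]
    rfl
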